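/- **Setting.** Let $p$ be a prime and put one $p$-level particle on each site of $\mathbb{Z}^3$. With $X|j\rangle=|j-1\rangle$, $Z|j\rangle=\omega^j|j\rangle$, $\omega=e^{2\pi i/p}$, a symplectic pair $A=(A_1,A_2)\in\mathbb{F}_p^2$ stands for $S_A=X^{A_1}Z^{A_2}$, and $\langle A,B\rangle=A_1B_2-A_2B_1$. For four labelled pairs $\alpha,\beta,\gamma,\delta$, the code $\mathcal{C}_S^{\alpha\beta\gamma\delta}$ (respectively $\mathcal{C}_A^{\alpha\beta\gamma\delta}$) has one stabilizer generator for every unit cube of the lattice: $\alpha,\beta,\gamma,\delta$ act, in cyclic order, on the four corners of the cube's face normal to the $x$-axis, and on the diametrically opposite corner of each of them acts the same pair (respectively its negative). A *logical string segment* of width $w\ge 1$ is a triple $(O,\Omega_1,\Omega_2)$ with $O$ a finitely supported Pauli operator and $\Omega_1,\Omega_2$ cubes of $w^3$ sites such that every stabilizer generator acting trivially on both $\Omega_1$ and $\Omega_2$ commutes with $O$. Its *length* is the $\ell_1$-norm of the displacement from $\Omega_1$ to $\Omega_2$. It is *connected* if some $p_1\in\Omega_1$ and $p_2\in\Omega_2$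 are joined by a path of sites inside $\operatorname{supp}(O)\cup\{p_1,p_2\}$ in which any two consecutive sites lie in the support of a common generator. It is *nontrivial* if every segment $(O',\Omega_1,\Omega_2)$ with $O'=Og$, $g$ a product of finitely many stabilizer generators, is connected. The code is *free of string logical operator with aspect ratio $r$* if every nontrivial logical string segment of width $w$ has length at most $rw$. For pairs $A,B$ let $T_{AB}=\begin{pmatrix}A_1&-A_2\\B_1&-B_2\end{pmatrix}$ and $T^{AB}_{CD}=T_{AB}^{-1}T_{CD}$. Consider the conditions 1. (deformability) $\langle A,B\rangle\neq0$ for any two different labels $A,B$ among $\alpha,\beta,\gamma,\delta$; 2. (absence of minimal string) $\det(T-T^{-1})\ne0$ for $T=T^{\gamma\beta}_{\delta\alpha},\,T^{\delta\gamma}_{\alpha\beta},\,T^{\gamma\beta}_{\alpha\delta}$; 3. $\langle A,B\rangle^2\neq\langle C,D\rangle^2$ whenever $A,B,C,D$ are the four labels in some order. **Corollary.** Let $p=5$ and let $\alpha,\beta,\gamma,\delta$ be the pairs $(1,0),(0,1),(1,1),(3,-3)$ over $\mathbb{F}_5$, in any order. Then conditions 1 and 2 hold, and both $\mathcal{C}_S^{\alpha\beta\gamma\delta}$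 and $\mathcal{C}_A^{\alpha\beta\gamma\delta}$ are free of string logical operator with aspect ratio $5$. Moreover, for a prime $p<5$, no choice of $\alpha,\beta,\gamma,\delta\in\mathbb{F}_p^2$ satisfies conditions 1, 2 and 3 together. -/

import Mathlib

noncomputable section

namespace QuditCode

/-- Sites of the infinite cubic lattice `ℤ³` (coordinates `0, 1, 2` are `x, y, z`). -/
abbrev Site : Type := Fin 3 → ℤ

/-- Symplectic pairs `(α₁, α₂)` over `𝔽_p`. -/
abbrev SympPair (p : ℕ) : Type := ZMod p × ZMod p

/-- The symplectic product `⟨α, β⟩ = α₁ β₂ - α₂ β₁`. -/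
def symp {p : ℕ} (α β : SympPair p) : ZMod p := α.1 * β.2 - α.2 * β.1

/-! ### Pauli operators on the lattice -/

/-- Computational basis labels: a value in `ℤ/p` for each site. -/
abbrev Config (p : ℕ) : Type := Site → ZMod p

/-- Finite superpositions of computational basis states of one `p`-level particle per site.
All finite Pauli operators act on this space. -/
abbrev LatticeState (p : ℕ) : Type := Config p →₀ ℂ

/-- The operator `∏ₛ X_s^{(u s)₁} Z_s^{(u s)₂}`, where at every site `Z |j⟩ = ω^j |j⟩` and
`X |j⟩ = |j - 1⟩` (that is, `X_{ij} = 1` iff `j = i + 1`), with `ω = exp (2πi/p)`. So it sends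
`|c⟩` to `ω^{∑ₛ (u s)₂ c(s)} |c - u₁⟩`. -/
def pauliProd {p : ℕ} [NeZero p] (u : Site →₀ SympPair p) : Module.End ℂ (LatticeState p) :=
  Finsupp.linearCombination ℂ fun c : Config p =>
    Finsupp.single (fun s => c s - (u s).1) (ZMod.stdAddChar (u.sum fun s a => a.2 * c s))

/-- A finite Pauli operator `ω^k ∏ₛ X_s^{(u s)₁} Z_s^{(u s)₂}`. -/
structure FinitePauli (p : ℕ) where
  phase : ZMod p
  pairs : Site →₀ SympPair p

/-- The operator on lattice states that a finite Pauli operator stands for. -/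
def FinitePauli.toEnd {p : ℕ} [NeZero p] (O : FinitePauli p) : Module.End ℂ (LatticeState p) :=
  (ZMod.stdAddChar O.phase : ℂ) • pauliProd O.pairs

/-- The set of sites on which a finite Pauli operator acts nontrivially. -/
def FinitePauli.supp {p : ℕ} (O : FinitePauli p) : Set Site := {s | O.pairs s ≠ 0}

/-! ### The codes `C_S^{αβγδ}` and `C_A^{αβγδ}` -/

/-- The symmetric and the antisymmetric family (under inversion of the unit cube). -/
inductive Family
  | symmetric
  | antisymmetric

/-- The sign relating the pairs at opposite corners of the cube. -/
def Family.sign : Family → ℤ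
  | .symmetric => 1
  | .antisymmetric => -1

/-- Position, in the unit cube, of the unprimed corners `α, β, γ, δ` (indices `0, 1, 2, 3`).
They lie in cyclic order on a face normal to the `x` direction; the primed corners
`α', β', γ', δ'` are the diametrically opposite ones. -/
def corner : Fin 4 → Site
  | 0 => ![0, 1, 1]
  | 1 => ![0, 0, 1]
  | 2 => ![0, 0, 0]
  | 3 => ![0, 1, 0]

/-- The stabilizer generator at the unit cube with lowest corner `c`: the pair `ξ a` sits at the
corner `a` and the pair `± ξ a` sits at the opposite corner. -/
def generator {p : ℕ} (F : Family) (ξ : Fin 4 → SympPair p) (c : Site) : FinitePauli p where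
  phase := 0
  pairs := ∑ a : Fin 4, (Finsupp.single (c + corner a) (ξ a) +
    Finsupp.single (c + (1 - corner a)) (F.sign • ξ a))

/-- The products of finitely many stabilizer generators. As every generator has finite order, this
is the stabilizer group. -/
def stabilizers {p : ℕ} [NeZero p] (F : Family) (ξ : Fin 4 → SympPair p) :
    Submonoid (Module.End ℂ (LatticeState p)) :=
  Submonoid.closure (Set.range fun c : Site => (generator F ξ c).toEnd)

/-! ### Paths and logical string segments -/

/-- Some stabilizer generator acts nontrivially on both sites. -/
def Linked {p : ℕ} (F : Family) (ξ : Fin 4 → SympPair p) (s t : Site) : Prop :=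
  ∃ c : Site, s ∈ (generator F ξ c).supp ∧ t ∈ (generator F ξ c).supp

/-- `s` and `t` are joined by a path whose sites all lie in `M`. -/
def JoinedIn {p : ℕ} (F : Family) (ξ : Fin 4 → SympPair p) (M : Set Site) (s t : Site) : Prop :=
  s ∈ M ∧ t ∈ M ∧
    Relation.ReflTransGen (fun a b => a ∈ M ∧ b ∈ M ∧ Linked F ξ a b) s t

/-- The cube of `w³` sites with lowest corner `q`. -/
def cube (w : ℕ) (q : Site) : Set Site := {s | ∀ i, q i ≤ s i ∧ s i < q i + w}

/-- `(O, Ω₁, Ω₂)` is a logical string segment, with anchors the `w³`-cubes at `q₁` and `q₂`: each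
generator acting trivially on both anchors commutes with `O`. -/
def IsStringSegment {p : ℕ} [NeZero p] (F : Family) (ξ : Fin 4 → SympPair p)
    (O : FinitePauli p) (w : ℕ) (q₁ q₂ : Site) : Prop :=
  ∀ c : Site, Disjoint (generator F ξ c).supp (cube w q₁) →
    Disjoint (generator F ξ c).supp (cube w q₂) →
    Commute (generator F ξ c).toEnd O.toEnd

/-- The segment `(O, Ω₁, Ω₂)` is connected. -/
def IsConnectedSegment {p : ℕ} (F : Family) (ξ : Fin 4 → SympPair p)
    (O : FinitePauli p) (w : ℕ) (q₁ q₂ : Site) : Prop :=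
  ∃ p₁ ∈ cube w q₁, ∃ p₂ ∈ cube w q₂, JoinedIn F ξ (O.supp ∪ {p₁, p₂}) p₁ p₂

/-- `O'` is obtained from `O` by multiplying finitely many stabilizer generators. -/
def StabEquiv {p : ℕ} [NeZero p] (F : Family) (ξ : Fin 4 → SympPair p)
    (O O' : FinitePauli p) : Prop :=
  ∃ g ∈ stabilizers F ξ, O'.toEnd = O.toEnd * g

/-- The segment `(O, Ω₁, Ω₂)` is nontrivial: every equivalent segment is connected. -/
def IsNontrivialSegment {p : ℕ} [NeZero p] (F : Family) (ξ : Fin 4 → SympPair p)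
    (O : FinitePauli p) (w : ℕ) (q₁ q₂ : Site) : Prop :=
  ∀ O' : FinitePauli p, IsStringSegment F ξ O' w q₁ q₂ → StabEquiv F ξ O O' →
    IsConnectedSegment F ξ O' w q₁ q₂

/-- The `l₁`-length of the directional vector. -/
def segmentLength (q₁ q₂ : Site) : ℤ := ∑ i, |q₂ i - q₁ i|

/-- The code is free of string logical operators with aspect ratio `r`: every nontrivial logical
string segment of width `w` has length at most `r w`. -/
def StringFree {p : ℕ} [NeZero p] (F : Family) (ξ : Fin 4 → SympPair p) (r : ℕ) : Prop :=
  ∀ (O : FinitePauli p) (w : ℕ) (q₁ q₂ : Site), 1 ≤ w →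
    IsStringSegment F ξ O w q₁ q₂ → IsNontrivialSegment F ξ O w q₁ q₂ →
    segmentLength q₁ q₂ ≤ r * w

/-! ### The algebraic conditions -/

/-- Deformability condition. -/
def Deformable {p : ℕ} (ξ : Fin 4 → SympPair p) : Prop :=
  ∀ i j, i ≠ j → symp (ξ i) (ξ j) ≠ 0

/-- The matrix `T_{AB}` with rows `(A₁, -A₂)` and `(B₁, -B₂)`. -/
def pairMatrix {p : ℕ} (A B : SympPair p) : Matrix (Fin 2) (Fin 2) (ZMod p) :=
  !![A.1, -A.2; B.1, -B.2]

/-- The transition matrix `T^{AB}_{CD} = (T_{AB})⁻¹ T_{CD}`. -/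
def transition {p : ℕ} (A B C D : SympPair p) : Matrix (Fin 2) (Fin 2) (ZMod p) :=
  (pairMatrix A B)⁻¹ * pairMatrix C D

/-- Absence of minimal string: `det (T - T⁻¹) ≠ 0` for
`T = T^{γβ}_{δα}, T^{δγ}_{αβ}, T^{γβ}_{αδ}`. -/
def NoMinimalString {p : ℕ} (ξ : Fin 4 → SympPair p) : Prop :=
  ∀ T ∈ ({transition (ξ 2) (ξ 1) (ξ 3) (ξ 0), transition (ξ 3) (ξ 2) (ξ 0) (ξ 1),
      transition (ξ 2) (ξ 1) (ξ 0) (ξ 3)} : Set (Matrix (Fin 2) (Fin 2) (ZMod p))),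
    (T - T⁻¹).det ≠ 0

/-- The third condition: `⟨A, B⟩² ≠ ⟨C, D⟩²` for distinct labels `A, B, C, D`. -/
def DistinctSquares {p : ℕ} (ξ : Fin 4 → SympPair p) : Prop :=
  ∀ i j k l : Fin 4, [i, j, k, l].Nodup → symp (ξ i) (ξ j) ^ 2 ≠ symp (ξ k) (ξ l) ^ 2

/-- The three conditions together: the sufficient condition for absence of strings. -/
def SufficientCondition {p : ℕ} (ξ : Fin 4 → SympPair p) : Prop :=
  Deformable ξ ∧ NoMinimalString ξ ∧ DistinctSquares ξ

/-- The symplectic pairs `(1,0), (0,1), (1,1), (3,-3)` over `𝔽₅`. -/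
def fivePairs : Fin 4 → SympPair 5 := ![(1, 0), (0, 1), (1, 1), (3, -3)]

end QuditCode

end

/-! Write an operator as a field of pairs on the lattice and a set of violated generators as a
finitely supported function on the lattice, i.e. a Laurent polynomial over `k = ZMod p`. The two
components of the eight corner vectors give two polynomials, affine in each of `x`, `y`, `z`, and
their common zeros form a curve. Evaluating a syndrome at a point `(x, y, z)` of this curve, with
`x` transcendental, gives a charge in `L`. Every operator has total charge zero
(`evalMap_syndrome`).

Two facts make the charge decisive. First, it is the only local obstruction: a neutral cluster in a
cube is created by an operator on that cube (`exists_onCube_of_evalMap_eq_zero`). This is a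
dimension count. It uses that the operators on a cube of side `w` without syndrome have dimension at
most `(w - 1)^3`, and that monomials with exponents at most `a, b, c ≥ 1` span dimension exactly `2
(a + b + c)` on the curve (`CubeCurve`). Second, opposite charges cannot sit far apart: if `E ≠ 0`
and its multiple by a monomial with exponents `n` both lie in the span of the box of side `w`, then
`∑ |n i| ≤ 3 w` (`CubeCurve.exponents_le'`).

So for a segment longer than `3 w` each end is neutral, and up to generators the operator splits
into pieces on the two anchors (`exists_split`). That product is disconnected, so aspect ratio 3,
and a fortiori 5, holds.

The curve exists with the right dimensions because eliminating one coordinate yields an irreducible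
biquadratic polynomial (`exists_cubeCurve`); for the given pairs over `ZMod 5` the required
inequalities are a finite check. For `p < 5` all nonzero squares equal 1, which contradicts
condition 3. -/

namespace QuditCode

/-! ### Spans of monomials at a point satisfying the cube relations -/

section CubeRelation

variable {k L : Type*} [Field k] [Field L] [Algebra k L]

/-- The monomial at a corner of the unit cube. -/
def cubeMon (x y z : L) (e : Bool × Bool × Bool) : L :=
  (if e.1 then x else 1) * (if e.2.1 then y else 1) * (if e.2.2 then z else 1)

/-- The diametrically opposite corner. -/
def antipode (e : Bool × Bool × Bool) : Bool × Bool × Bool := (!e.1, !e.2.1, !e.2.2)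

/-- Any two corners of a unit cube that are not diametrically opposite depend linearly on the
other six. -/
def CubeRule (k : Type*) {L : Type*} [Field k] [Field L] [Algebra k L] (x y z : L) : Prop :=
  ∀ (W : Submodule k L) (m : L) (e d : Bool × Bool × Bool), e ≠ d → e ≠ antipode d →
    (∀ n, n ≠ e → n ≠ d → m * cubeMon x y z n ∈ W) → m * cubeMon x y z e ∈ W

/-- The span of the monomials with exponents at most `a`, `b`, `c`. -/
def boxSpan (k : Type*) {L : Type*} [Field k] [Field L] [Algebra k L] (x y z : L) (a b c : ℕ) :
    Submodule k L :=
  Submodule.span k {m | ∃ i ≤ a, ∃ j ≤ b, ∃ l ≤ c, m = x ^ i * y ^ j * z ^ l}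

lemma CubeRule.swap12 {x y z : L} (h : CubeRule k x y z) : CubeRule k y x z := by
  intro W m e d h1 h2 h3
  have := h W m (e.2.1, e.1, e.2.2) (d.2.1, d.1, d.2.2)
    (by rintro hh; apply h1; simp only [Prod.ext_iff] at hh ⊢; tauto)
    (by rintro hh; apply h2; simp only [antipode, Prod.ext_iff] at hh ⊢; tauto)
    (by
      intro n hn1 hn2
      have := h3 (n.2.1, n.1, n.2.2)
        (by rintro hh; apply hn1; simp only [Prod.ext_iff] at hh ⊢; tauto)
        (by rintro hh; apply hn2; simp only [Prod.ext_iff] at hh ⊢; tauto)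
      convert this using 1
      simp only [cubeMon]; ring)
  convert this using 1
  simp only [cubeMon]; ring

lemma CubeRule.swap23 {x y z : L} (h : CubeRule k x y z) : CubeRule k x z y := by
  intro W m e d h1 h2 h3
  have := h W m (e.1, e.2.2, e.2.1) (d.1, d.2.2, d.2.1)
    (by rintro hh; apply h1; simp only [Prod.ext_iff] at hh ⊢; tauto)
    (by rintro hh; apply h2; simp only [antipode, Prod.ext_iff] at hh ⊢; tauto)
    (by
      intro n hn1 hn2
      have := h3 (n.1, n.2.2, n.2.1)
        (by rintro hh; apply hn1; simp only [Prod.ext_iff] at hh ⊢; tauto)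
        (by rintro hh; apply hn2; simp only [Prod.ext_iff] at hh ⊢; tauto)
      convert this using 1
      simp only [cubeMon]; ring)
  convert this using 1
  simp only [cubeMon]; ring

/-- Reflecting the cube in the `x` direction and translating by `x⁻¹` permutes the corners and
preserves antipodality. -/
lemma CubeRule.inv1 {x y z : L} (hx : x ≠ 0) (h : CubeRule k x y z) : CubeRule k x⁻¹ y z := by
  have key : ∀ (m : L) (e : Bool × Bool × Bool),
      m * x⁻¹ * cubeMon x y z (!e.1, e.2) = m * cubeMon x⁻¹ y z e := by
    rintro m ⟨e1, e2⟩
    cases e1 <;> simp [cubeMon] <;> field_simp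
  intro W m e d h1 h2 h3
  rw [← key]
  refine h W (m * x⁻¹) (!e.1, e.2) (!d.1, d.2)
    (by rintro hh; apply h1; simp only [Prod.ext_iff, Bool.not_inj_iff] at hh ⊢; tauto)
    (by
      rintro hh; apply h2; simp only [antipode, Prod.ext_iff, Bool.not_inj_iff] at hh ⊢
      tauto)
    (by
      intro n hn1 hn2
      have := h3 (!n.1, n.2)
        (by rintro rfl; apply hn1; simp)
        (by rintro rfl; apply hn2; simp)
      rw [← key] at this
      simpa using this)

/-- Pairing the vector relation with `v d` removes corner `d` and leaves corner `e` with a nonzero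
determinant as coefficient, so the other six corners determine it. -/
lemma CubeRule.of_relation {x y z : L} (v : Bool × Bool × Bool → k × k)
    (hv : ∀ e d, e ≠ d → e ≠ antipode d → (v e).1 * (v d).2 - (v e).2 * (v d).1 ≠ 0)
    (h1 : ∑ e, (v e).1 • cubeMon x y z e = 0) (h2 : ∑ e, (v e).2 • cubeMon x y z e = 0) :
    CubeRule k x y z := by
  intro W m e d hed hea hW
  have h3 : ∑ n, ((v n).1 * (v d).2 - (v n).2 * (v d).1) • (m * cubeMon x y z n) = 0 := by
    have : ∑ n, ((v n).1 * (v d).2 - (v n).2 * (v d).1) • (m * cubeMon x y z n) =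
        (v d).2 • (m * ∑ n, (v n).1 • cubeMon x y z n) -
        (v d).1 • (m * ∑ n, (v n).2 • cubeMon x y z n) := by
      rw [Finset.mul_sum, Finset.mul_sum, Finset.smul_sum, Finset.smul_sum,
        ← Finset.sum_sub_distrib]
      refine Finset.sum_congr rfl fun n _ => ?_
      rw [sub_smul, mul_smul_comm, mul_smul_comm, smul_smul, smul_smul]
      congr 2 <;> ring
    rw [this, h1, h2]; simp
  rw [← Finset.add_sum_erase _ _ (Finset.mem_univ e)] at h3
  have h4 : ((v e).1 * (v d).2 - (v e).2 * (v d).1) • (m * cubeMon x y z e) ∈ W := by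
    rw [eq_neg_of_add_eq_zero_left h3]
    refine W.neg_mem (W.sum_mem fun n hn => ?_)
    by_cases hnd : n = d
    · subst hnd
      have : (v n).1 * (v n).2 - (v n).2 * (v n).1 = 0 := by ring
      rw [this, zero_smul]; exact W.zero_mem
    · exact W.smul_mem _ (hW n (Finset.ne_of_mem_erase hn) hnd)
  exact (W.smul_mem_iff (hv e d hed hea)).1 h4

/-- In a layer next to known monomials, two adjacent corner monomials determine all. -/
lemma CubeRule.layer {x y z : L} (h : CubeRule k x y z) (W : Submodule k L) (F : L) {b c : ℕ}
    (hb : 1 ≤ b) (hc : 1 ≤ c)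
    (hface : ∀ j ≤ b, ∀ l ≤ c, F * x * y ^ j * z ^ l ∈ W) (h0 : F ∈ W) (h1 : F * y ∈ W) :
    ∀ j ≤ b, ∀ l ≤ c, F * y ^ j * z ^ l ∈ W := by
  have row : ∀ l ≤ c, F * z ^ l ∈ W ∧ F * y * z ^ l ∈ W := by
    intro l
    induction l with
    | zero => intro _; simpa using ⟨h0, h1⟩
    | succ l ih =>
      intro hl
      obtain ⟨i0, i1⟩ := ih (by omega)
      have hall : ∀ n, n ≠ (false, false, true) → n ≠ (false, true, true) →
          F * z ^ l * cubeMon x y z n ∈ W := by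
        rintro ⟨_ | _, _ | _, _ | _⟩ hn1 hn2 <;> simp at hn1 hn2
        · simpa [cubeMon] using i0
        · convert i1 using 1; simp [cubeMon]; ring
        · convert hface 0 (by omega) l (by omega) using 1; simp [cubeMon]; ring
        · convert hface 0 (by omega) (l + 1) (by omega) using 1; simp [cubeMon]; ring
        · convert hface 1 (by omega) l (by omega) using 1; simp [cubeMon]; ring
        · convert hface 1 (by omega) (l + 1) (by omega) using 1; simp [cubeMon]; ring
      constructor
      · convert h W (F * z ^ l) (false, false, true) (false, true, true) (by decide) (by decide)
          hall using 1
        simp [cubeMon]; ring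
      · convert h W (F * z ^ l) (false, true, true) (false, false, true) (by decide) (by decide)
          (fun n a b => hall n b a) using 1
        simp [cubeMon]; ring
  intro j
  induction j with
  | zero => intro _ l hl; simpa using (row l hl).1
  | succ j ih =>
    intro hj
    have ih' := ih (by omega)
    -- Here the two unknown corners form an edge in the `z` direction, so both ends must lie in the
    -- box; `1 ≤ c` guarantees that every `l ≤ c` is an end of such an edge.
    have step : ∀ l, l + 1 ≤ c → F * y ^ (j + 1) * z ^ l ∈ W ∧
        F * y ^ (j + 1) * z ^ (l + 1) ∈ W := by
      intro l hl
      have hall : ∀ n, n ≠ (false, true, false) → n ≠ (false, true, true) →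
          F * y ^ j * z ^ l * cubeMon x y z n ∈ W := by
        rintro ⟨_ | _, _ | _, _ | _⟩ hn1 hn2 <;> simp at hn1 hn2
        · simpa [cubeMon] using ih' l (by omega)
        · convert ih' (l + 1) (by omega) using 1; simp [cubeMon]; ring
        · convert hface j (by omega) l (by omega) using 1; simp [cubeMon]; ring
        · convert hface j (by omega) (l + 1) (by omega) using 1; simp [cubeMon]; ring
        · convert hface (j + 1) (by omega) l (by omega) using 1; simp [cubeMon]; ring
        · convert hface (j + 1) (by omega) (l + 1) (by omega) using 1; simp [cubeMon]; ring
      constructor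
      · convert h W (F * y ^ j * z ^ l) (false, true, false) (false, true, true) (by decide)
          (by decide) hall using 1
        simp [cubeMon]; ring
      · convert h W (F * y ^ j * z ^ l) (false, true, true) (false, true, false) (by decide)
          (by decide) (fun n a b => hall n b a) using 1
        simp [cubeMon]; ring
    intro l hl
    rcases Nat.lt_or_ge l c with h' | h'
    · exact (step l h').1
    · obtain ⟨c', rfl⟩ : ∃ c', l = c' + 1 := ⟨l - 1, by omega⟩
      exact (step c' hl).2

/-- Layers are filled one after the other. -/
lemma CubeRule.fill {x y z : L} (h : CubeRule k x y z) (W : Submodule k L) (F : L) {b c : ℕ}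
    (hb : 1 ≤ b) (hc : 1 ≤ c) (a : ℕ)
    (hface : ∀ j ≤ b, ∀ l ≤ c, F * x ^ a * y ^ j * z ^ l ∈ W)
    (hseed : ∀ i < a, F * x ^ i ∈ W ∧ F * x ^ i * y ∈ W) :
    ∀ i ≤ a, ∀ j ≤ b, ∀ l ≤ c, F * x ^ i * y ^ j * z ^ l ∈ W := by
  intro i hi
  induction hi using Nat.decreasingInduction with
  | self => exact hface
  | of_succ i hi ih =>
    refine h.layer W (F * x ^ i) hb hc ?_ (hseed i hi).1 (hseed i hi).2
    intro j hj l hl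
    convert ih j hj l hl using 1
    ring

lemma mem_boxSpan {x y z : L} {a b c i j l : ℕ} (hi : i ≤ a) (hj : j ≤ b) (hl : l ≤ c) :
    x ^ i * y ^ j * z ^ l ∈ boxSpan k x y z a b c :=
  Submodule.subset_span ⟨i, hi, j, hj, l, hl, rfl⟩

lemma boxSpan_le {x y z : L} {a b c : ℕ} {W : Submodule k L}
    (h : ∀ i ≤ a, ∀ j ≤ b, ∀ l ≤ c, x ^ i * y ^ j * z ^ l ∈ W) : boxSpan k x y z a b c ≤ W := by
  refine Submodule.span_le.2 ?_
  rintro _ ⟨i, hi, j, hj, l, hl, rfl⟩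
  exact h i hi j hj l hl

lemma boxSpan_mono {x y z : L} {a b c a' b' c' : ℕ} (ha : a ≤ a') (hb : b ≤ b') (hc : c ≤ c') :
    boxSpan k x y z a b c ≤ boxSpan k x y z a' b' c' :=
  boxSpan_le fun _ hi _ hj _ hl => mem_boxSpan (hi.trans ha) (hj.trans hb) (hl.trans hc)

lemma boxSpan_swap12 (x y z : L) (a b c : ℕ) :
    boxSpan k y x z b a c = boxSpan k x y z a b c := by
  apply le_antisymm <;> refine boxSpan_le fun i hi j hj l hl => ?_ <;>
  · rw [mul_comm (_ ^ i)]; exact mem_boxSpan hj hi hl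

lemma boxSpan_swap23 (x y z : L) (a b c : ℕ) :
    boxSpan k x z y a c b = boxSpan k x y z a b c := by
  apply le_antisymm <;> refine boxSpan_le fun i hi j hj l hl => ?_ <;>
  · rw [mul_assoc, mul_comm (_ ^ j), ← mul_assoc]; exact mem_boxSpan hi hl hj

open Classical in
lemma boxSpan_eq_span_image (x y z : L) (a b c : ℕ) :
    boxSpan k x y z a b c = Submodule.span k
      (((Finset.range (a + 1) ×ˢ Finset.range (b + 1) ×ˢ Finset.range (c + 1)).image
        fun t : ℕ × ℕ × ℕ => x ^ t.1 * y ^ t.2.1 * z ^ t.2.2 : Finset L) : Set L) := by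
  rw [boxSpan]
  congr 1
  ext m
  simp only [Set.mem_ofPred_eq, Finset.coe_image, Set.mem_image, Finset.mem_coe,
    Finset.mem_product, Finset.mem_range, Prod.exists, Nat.lt_succ_iff]
  constructor
  · rintro ⟨i, hi, j, hj, l, hl, rfl⟩; exact ⟨i, j, l, ⟨hi, hj, hl⟩, rfl⟩
  · rintro ⟨i, j, l, ⟨hi, hj, hl⟩, rfl⟩; exact ⟨i, hi, j, hj, l, hl, rfl⟩

instance (x y z : L) (a b c : ℕ) : FiniteDimensional k (boxSpan k x y z a b c) := by
  classical
  rw [boxSpan_eq_span_image]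
  exact FiniteDimensional.span_finset k _

lemma finrank_boxSpan_le (x y z : L) (a b c : ℕ) :
    Module.finrank k (boxSpan k x y z a b c) ≤ (a + 1) * ((b + 1) * (c + 1)) := by
  classical
  rw [boxSpan_eq_span_image]
  refine (finrank_span_finset_le_card _).trans (Finset.card_image_le.trans ?_)
  simp

lemma finrank_map_mulLeft {m : L} (hm : m ≠ 0) (W : Submodule k L) :
    Module.finrank k (W.map (LinearMap.mulLeft k m)) = Module.finrank k W :=
  (Submodule.equivMapOfInjective (LinearMap.mulLeft k m) (mul_right_injective₀ hm) W).finrank_eq.symm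

/-- Shifting by `x` supplies every layer but the one at `x ^ 0`, and `CubeRule.layer` rebuilds that
one from the seeds `1` and `y`. A new layer therefore costs at most two dimensions, whatever `b` and
`c` are. -/
lemma boxSpan_succ {x y z : L} (h : CubeRule k x y z) (a : ℕ) {b c : ℕ} (hb : 1 ≤ b)
    (hc : 1 ≤ c) : boxSpan k x y z (a + 1) b c =
      (boxSpan k x y z a b c).map (LinearMap.mulLeft k x) ⊔ Submodule.span k {1, y} := by
  have hmul : ∀ i ≤ a, ∀ j ≤ b, ∀ l ≤ c, x ^ (i + 1) * y ^ j * z ^ l ∈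
      (boxSpan k x y z a b c).map (LinearMap.mulLeft k x) := by
    intro i hi j hj l hl
    refine ⟨_, mem_boxSpan hi hj hl, ?_⟩
    change x * (x ^ i * y ^ j * z ^ l) = _
    ring
  apply le_antisymm
  · refine boxSpan_le fun i hi j hj l hl => ?_
    rcases i with _ | i
    · have := h.layer ((boxSpan k x y z a b c).map (LinearMap.mulLeft k x) ⊔
        Submodule.span k {1, y}) 1 hb hc (fun j hj l hl => Submodule.mem_sup_left
          (by simpa using hmul 0 (by omega) j hj l hl))
        (Submodule.mem_sup_right (Submodule.subset_span (by simp)))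
        (Submodule.mem_sup_right (Submodule.subset_span (by simp))) j hj l hl
      simpa using this
    · exact Submodule.mem_sup_left (hmul i (by omega) j hj l hl)
  · refine sup_le ?_ ?_
    · rw [Submodule.map_le_iff_le_comap]
      refine boxSpan_le fun i hi j hj l hl => ?_
      have : x ^ (i + 1) * y ^ j * z ^ l ∈ boxSpan k x y z (a + 1) b c :=
        mem_boxSpan (by omega) hj hl
      rw [Submodule.mem_comap, LinearMap.mulLeft_apply]
      convert this using 1
      ring
    · rw [Submodule.span_le]
      rintro m (rfl | rfl)
      · simpa using (mem_boxSpan (k := k) (x := x) (y := y) (z := z) (Nat.zero_le (a + 1))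
          (Nat.zero_le b) (Nat.zero_le c))
      · simpa using (mem_boxSpan (k := k) (x := x) (y := m) (z := z) (Nat.zero_le (a + 1))
          hb (Nat.zero_le c))

/-- The shifted boxes increase with `a`, so their intersection with the span of `1, y` does too. If
one layer gained less than two dimensions, all later ones would gain at most one, against the growth
rate two in `hs`. -/
lemma finrank_boxSpan_succ {x y z : L} (hx : x ≠ 0) (h : CubeRule k x y z)
    (hs : ∀ n, 2 * (n + 1) ≤ Module.finrank k (boxSpan k x y z n 1 0)) (a : ℕ) {b c : ℕ}
    (hb : 1 ≤ b) (hc : 1 ≤ c) :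
    Module.finrank k (boxSpan k x y z (a + 1) b c) =
      Module.finrank k (boxSpan k x y z a b c) + 2 := by
  set V : ℕ → Submodule k L := fun n => boxSpan k x y z n b c with hV
  set S : Submodule k L := Submodule.span k {1, y} with hS
  have hSfin : FiniteDimensional k S := FiniteDimensional.span_of_finite k (by simp)
  have hS2 : Module.finrank k S ≤ 2 := by
    classical
    have := finrank_span_finset_le_card (R := k) ({1, y} : Finset L)
    rw [Finset.coe_pair] at this
    exact this.trans Finset.card_le_two
  have hsum : ∀ n, Module.finrank k (V (n + 1)) +
      Module.finrank k ((V n).map (LinearMap.mulLeft k x) ⊓ S : Submodule k L) =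
      Module.finrank k (V n) + Module.finrank k S := by
    intro n
    rw [← finrank_map_mulLeft hx (V n),
      ← Submodule.finrank_sup_add_finrank_inf_eq ((V n).map (LinearMap.mulLeft k x)) S]
    change Module.finrank k (boxSpan k x y z (n + 1) b c) + _ = _
    rw [boxSpan_succ h n hb hc]
  have hmono : ∀ n t, Module.finrank k ((V n).map (LinearMap.mulLeft k x) ⊓ S : Submodule k L) ≤
      Module.finrank k ((V (n + t)).map (LinearMap.mulLeft k x) ⊓ S : Submodule k L) := by
    intro n t
    refine Submodule.finrank_mono (inf_le_inf_right _ (Submodule.map_mono ?_))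
    exact boxSpan_mono (by omega) le_rfl le_rfl
  by_contra hne
  have h1 : Module.finrank k (V (a + 1)) ≤ Module.finrank k (V a) + 1 := by
    have := hsum a
    change Module.finrank k (V (a + 1)) ≠ Module.finrank k (V a) + 2 at hne
    omega
  have h2 : ∀ t, Module.finrank k (V (a + t)) ≤ Module.finrank k (V a) + t := by
    intro t
    induction t with
    | zero => simp
    | succ t ih =>
      have e1 := hsum a
      have e2 := hsum (a + t)
      have e3 := hmono a t
      rw [← add_assoc]
      omega
  -- With `D` the dimension of `V a`, going `D` layers further gives at most `2 D`, while `hs`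
  -- demands at least `2 (a + D + 1)`.
  have h3 := h2 (Module.finrank k (V a))
  have h4 := hs (a + Module.finrank k (V a))
  have h5 : Module.finrank k (boxSpan k x y z (a + Module.finrank k (V a)) 1 0) ≤
      Module.finrank k (V (a + Module.finrank k (V a))) :=
    Submodule.finrank_mono (boxSpan_mono le_rfl hb (Nat.zero_le _))
  omega

/-- The cube relations together with the dimensions of the spans of boxes of monomials. -/
structure CubeCurve (k : Type*) {L : Type*} [Field k] [Field L] [Algebra k L] (x y z : L) :
    Prop where
  ne1 : x ≠ 0
  ne2 : y ≠ 0
  ne3 : z ≠ 0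
  rule : CubeRule k x y z
  finrank : ∀ a b c, 1 ≤ a → 1 ≤ b → 1 ≤ c →
    Module.finrank k (boxSpan k x y z a b c) = 2 * (a + b + c)

/-- Each of the three directions grows by exactly two per layer, starting from the `1, 1, 0` box,
whose four monomials are independent. -/
lemma CubeCurve.of_slopes {x y z : L} (hx : x ≠ 0) (hy : y ≠ 0) (hz : z ≠ 0)
    (h : CubeRule k x y z)
    (h1 : ∀ n, 2 * (n + 1) ≤ Module.finrank k (boxSpan k x y z n 1 0))
    (h2 : ∀ n, 2 * (n + 1) ≤ Module.finrank k (boxSpan k y x z n 1 0))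
    (h3 : ∀ n, 2 * (n + 1) ≤ Module.finrank k (boxSpan k z x y n 1 0)) : CubeCurve k x y z where
  ne1 := hx
  ne2 := hy
  ne3 := hz
  rule := h
  finrank := by
    have s1 : ∀ a b c, 1 ≤ b → 1 ≤ c → Module.finrank k (boxSpan k x y z (a + 1) b c) =
        Module.finrank k (boxSpan k x y z a b c) + 2 := fun a b c hb hc =>
      finrank_boxSpan_succ hx h h1 a hb hc
    have s2 : ∀ a b c, 1 ≤ a → 1 ≤ c → Module.finrank k (boxSpan k x y z a (b + 1) c) =
        Module.finrank k (boxSpan k x y z a b c) + 2 := fun a b c hb hc => by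
      have := finrank_boxSpan_succ hy h.swap12 h2 b hb hc
      rwa [boxSpan_swap12 x y z a (b + 1) c, boxSpan_swap12 x y z a b c] at this
    have s3 : ∀ a b c, 1 ≤ a → 1 ≤ b → Module.finrank k (boxSpan k x y z a b (c + 1)) =
        Module.finrank k (boxSpan k x y z a b c) + 2 := fun a b c hb hc => by
      have := finrank_boxSpan_succ hz h.swap23.swap12 h3 c hb hc
      rwa [boxSpan_swap12 x z y a (c + 1) b, boxSpan_swap12 x z y a c b,
        boxSpan_swap23 x y z a b (c + 1), boxSpan_swap23 x y z a b c] at this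
    have h0 : Module.finrank k (boxSpan k x y z 1 1 0) = 4 :=
      le_antisymm (finrank_boxSpan_le x y z 1 1 0) (h1 1)
    intro a b c ha hb hc
    induction a, ha using Nat.le_induction with
    | succ a ha ih => rw [s1 a b c hb hc, ih]; ring
    | base =>
      induction b, hb using Nat.le_induction with
      | succ b hb ih => rw [s2 1 b c le_rfl hc, ih]; ring
      | base =>
        induction c, hc using Nat.le_induction with
        | succ c hc ih => rw [s3 1 1 c le_rfl le_rfl, ih]; ring
        | base => rw [s3 1 1 0 le_rfl le_rfl, h0]

lemma CubeCurve.swap12 {x y z : L} (h : CubeCurve k x y z) : CubeCurve k y x z where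
  ne1 := h.ne2
  ne2 := h.ne1
  ne3 := h.ne3
  rule := h.rule.swap12
  finrank a b c ha hb hc := by
    rw [boxSpan_swap12, h.finrank b a c hb ha hc]; ring

lemma CubeCurve.swap23 {x y z : L} (h : CubeCurve k x y z) : CubeCurve k x z y where
  ne1 := h.ne1
  ne2 := h.ne3
  ne3 := h.ne2
  rule := h.rule.swap23
  finrank a b c ha hb hc := by
    rw [boxSpan_swap23, h.finrank a c b ha hc hb]; ring

lemma map_boxSpan_inv1 {x y z : L} (hx : x ≠ 0) (a b c : ℕ) :
    (boxSpan k x y z a b c).map (LinearMap.mulLeft k (x⁻¹ ^ a)) = boxSpan k x⁻¹ y z a b c := by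
  have hpow : ∀ i ≤ a, x⁻¹ ^ a * x ^ i = x⁻¹ ^ (a - i) := by
    intro i hi
    obtain ⟨t, rfl⟩ := Nat.exists_eq_add_of_le hi
    rw [Nat.add_sub_cancel_left, pow_add, mul_right_comm, ← mul_pow, inv_mul_cancel₀ hx, one_pow,
      one_mul]
  apply le_antisymm
  · rw [Submodule.map_le_iff_le_comap]
    refine boxSpan_le fun i hi j hj l hl => ?_
    rw [Submodule.mem_comap, LinearMap.mulLeft_apply, ← mul_assoc, ← mul_assoc, hpow i hi]
    exact mem_boxSpan (Nat.sub_le _ _) hj hl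
  · refine boxSpan_le fun i hi j hj l hl => ⟨_, mem_boxSpan (Nat.sub_le a i) hj hl, ?_⟩
    rw [LinearMap.mulLeft_apply, ← mul_assoc, ← mul_assoc, hpow _ (Nat.sub_le a i),
      Nat.sub_sub_self hi]

lemma CubeCurve.inv1 {x y z : L} (h : CubeCurve k x y z) : CubeCurve k x⁻¹ y z where
  ne1 := inv_ne_zero h.ne1
  ne2 := h.ne2
  ne3 := h.ne3
  rule := h.rule.inv1 h.ne1
  finrank a b c ha hb hc := by
    rw [← map_boxSpan_inv1 h.ne1, finrank_map_mulLeft (pow_ne_zero _ (inv_ne_zero h.ne1)),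
      h.finrank a b c ha hb hc]

/-- Multiples of `E` by a large cube of monomials and by its translate all lie in one box span. The
cube rule fills in the bounding box of the two cubes, direction by direction, and comparing
dimensions of the bounding box and of the ambient box bounds the displacement. -/
lemma CubeCurve.exponents_le {x y z : L} (h : CubeCurve k x y z) {w a b c : ℕ} {E : L}
    (hE : E ≠ 0) (h1 : E ∈ boxSpan k x y z w w w)
    (h2 : x ^ a * y ^ b * z ^ c * E ∈ boxSpan k x y z w w w) : a + b + c ≤ 3 * w := by
  -- Large enough that the untranslated cube contains the seed edges used below, one of which
  -- reaches exponent `b + 1`.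
  set n := a + b + c + 1 with hn
  set W := boxSpan k x y z (n + w) (n + w) (n + w) with hW
  have hmul : ∀ F ∈ boxSpan k x y z w w w, ∀ i ≤ n, ∀ j ≤ n, ∀ l ≤ n,
      F * x ^ i * y ^ j * z ^ l ∈ W := by
    intro F hF i hi j hj l hl
    have : boxSpan k x y z w w w ≤ W.comap (LinearMap.mulRight k (x ^ i * y ^ j * z ^ l)) := by
      refine boxSpan_le fun i' hi' j' hj' l' hl' => ?_
      have : x ^ (i' + i) * y ^ (j' + j) * z ^ (l' + l) ∈ W :=
        mem_boxSpan (by omega) (by omega) (by omega)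
      rw [Submodule.mem_comap, LinearMap.mulRight_apply]
      convert this using 1
      ring
    have := this hF
    simpa only [Submodule.mem_comap, LinearMap.mulRight_apply, ← mul_assoc] using this
  have b1 : ∀ i ≤ n, ∀ j ≤ n, ∀ l ≤ n, E * x ^ i * y ^ j * z ^ l ∈ W := hmul E h1
  have b2 : ∀ i ≤ n, ∀ j ≤ n, ∀ l ≤ n,
      E * x ^ (a + i) * y ^ (b + j) * z ^ (c + l) ∈ W := by
    intro i hi j hj l hl
    convert hmul _ h2 i hi j hj l hl using 1
    ring
  have f1 : ∀ i ≤ n + a, ∀ j ≤ n, ∀ l ≤ n, E * x ^ i * y ^ (b + j) * z ^ (c + l) ∈ W := by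
    have := h.rule.fill W (E * y ^ b * z ^ c) (b := n) (c := n) (by omega) (by omega) a
      (fun j hj l hl => by convert b2 0 (by omega) j hj l hl using 1; ring)
      (fun i hi => ⟨by convert b1 i (by omega) b (by omega) c (by omega) using 1; ring,
        by convert b1 i (by omega) (b + 1) (by omega) c (by omega) using 1; ring⟩)
    intro i hi j hj l hl
    rcases le_or_gt i a with hia | hia
    · convert this i hia j hj l hl using 1; ring
    · simpa only [Nat.add_sub_cancel' hia.le] using b2 (i - a) (by omega) j hj l hl
  have f2 : ∀ i ≤ n + a, ∀ j ≤ n + b, ∀ l ≤ n, E * x ^ i * y ^ j * z ^ (c + l) ∈ W := by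
    have := h.rule.swap12.fill W (E * z ^ c) (b := n + a) (c := n) (by omega) (by omega) b
      (fun i hi l hl => by convert f1 i hi 0 (by omega) l hl using 1; ring)
      (fun j hj => ⟨by convert b1 0 (by omega) j (by omega) c (by omega) using 1; ring,
        by convert b1 1 (by omega) j (by omega) c (by omega) using 1; ring⟩)
    intro i hi j hj l hl
    rcases le_or_gt j b with hjb | hjb
    · convert this j hjb i hi l hl using 1; ring
    · simpa only [Nat.add_sub_cancel' hjb.le] using f1 i hi (j - b) (by omega) l hl
  have f3 : ∀ i ≤ n + a, ∀ j ≤ n + b, ∀ l ≤ n + c, E * x ^ i * y ^ j * z ^ l ∈ W := by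
    have := h.rule.swap23.swap12.fill W E (b := n + a) (c := n + b) (by omega) (by omega) c
      (fun i hi j hj => by convert f2 i hi j hj 0 (by omega) using 1; ring)
      (fun l hl => ⟨by convert b1 0 (by omega) 0 (by omega) l (by omega) using 1; ring,
        by convert b1 1 (by omega) 0 (by omega) l (by omega) using 1; ring⟩)
    intro i hi j hj l hl
    rcases le_or_gt l c with hlc | hlc
    · convert this l hlc i hi j hj using 1; ring
    · simpa only [Nat.add_sub_cancel' hlc.le] using f2 i hi j hj (l - c) (by omega)
  have hle : (boxSpan k x y z (n + a) (n + b) (n + c)).map (LinearMap.mulLeft k E) ≤ W := by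
    rw [Submodule.map_le_iff_le_comap]
    refine boxSpan_le fun i hi j hj l hl => ?_
    rw [Submodule.mem_comap, LinearMap.mulLeft_apply, ← mul_assoc, ← mul_assoc]
    exact f3 i hi j hj l hl
  have := Submodule.finrank_mono hle
  rw [finrank_map_mulLeft hE, h.finrank _ _ _ (by omega) (by omega) (by omega), hW,
    h.finrank _ _ _ (by omega) (by omega) (by omega)] at this
  omega

/-- Inverting a coordinate reverses the sign of its exponent and preserves both the curve and, up to
a monomial factor, the box; coordinate swaps bring each exponent in turn to first place. -/
lemma CubeCurve.exponents_le' {x y z : L} (h : CubeCurve k x y z) {w : ℕ} (n : Fin 3 → ℤ) {E : L}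
    (hE : E ≠ 0) (h1 : E ∈ boxSpan k x y z w w w)
    (h2 : x ^ n 0 * y ^ n 1 * z ^ n 2 * E ∈ boxSpan k x y z w w w) :
    ∑ i, |n i| ≤ 3 * w := by
  rw [Fin.sum_univ_three]
  generalize n 0 = a at *
  generalize n 1 = b at *
  generalize n 2 = c at *
  have flip : ∀ {x y z E : L} (t : ℤ) (f : L), CubeCurve k x y z → t < 0 → E ≠ 0 →
      E ∈ boxSpan k x y z w w w → x ^ t * f * E ∈ boxSpan k x y z w w w →
      CubeCurve k x⁻¹ y z ∧ ∃ E', E' ≠ 0 ∧ E' ∈ boxSpan k x⁻¹ y z w w w ∧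
        x⁻¹ ^ (-t) * f * E' ∈ boxSpan k x⁻¹ y z w w w := by
    intro x y z E t f h ht hE h1 h2
    refine ⟨h.inv1, x⁻¹ ^ w * E, mul_ne_zero (pow_ne_zero _ (inv_ne_zero h.ne1)) hE, ?_, ?_⟩
    · rw [← map_boxSpan_inv1 h.ne1]; exact ⟨E, h1, rfl⟩
    · rw [← map_boxSpan_inv1 h.ne1]; refine ⟨_, h2, ?_⟩
      rw [LinearMap.mulLeft_apply, inv_zpow, ← zpow_neg, neg_neg]; ring
  have key1 : ∀ {x y z E : L} (a : ℤ) (b c : ℕ), CubeCurve k x y z → E ≠ 0 →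
      E ∈ boxSpan k x y z w w w → x ^ a * (y ^ b * z ^ c) * E ∈ boxSpan k x y z w w w →
      |a| + b + c ≤ 3 * w := by
    have pos : ∀ {x y z E : L} (a : ℤ) (b c : ℕ), 0 ≤ a → CubeCurve k x y z → E ≠ 0 →
      E ∈ boxSpan k x y z w w w → x ^ a * (y ^ b * z ^ c) * E ∈ boxSpan k x y z w w w →
      |a| + b + c ≤ 3 * w := by
      intro x y z E a b c ha h hE h1 h2
      obtain ⟨a, rfl⟩ := Int.eq_ofNat_of_zero_le ha
      rw [zpow_natCast, ← mul_assoc] at h2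
      have := h.exponents_le hE h1 h2
      rw [abs_of_nonneg ha]; omega
    intro x y z E a b c h hE h1 h2
    rcases le_or_gt 0 a with ha | ha
    · exact pos a b c ha h hE h1 h2
    · obtain ⟨h', E', hE', h1', h2'⟩ := flip a _ h ha hE h1 h2
      simpa using pos (-a) b c (by omega) h' hE' h1' h2'
  have key2 : ∀ {x y z E : L} (a b : ℤ) (c : ℕ), CubeCurve k x y z → E ≠ 0 →
      E ∈ boxSpan k x y z w w w → x ^ a * (y ^ b * z ^ c) * E ∈ boxSpan k x y z w w w →
      |a| + |b| + c ≤ 3 * w := by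
    have pos : ∀ {x y z E : L} (a b : ℤ) (c : ℕ), 0 ≤ a → CubeCurve k x y z → E ≠ 0 →
      E ∈ boxSpan k x y z w w w → x ^ a * (y ^ b * z ^ c) * E ∈ boxSpan k x y z w w w →
      |a| + |b| + c ≤ 3 * w := by
      intro x y z E a b c ha h hE h1 h2
      obtain ⟨a, rfl⟩ := Int.eq_ofNat_of_zero_le ha
      rw [← boxSpan_swap12] at h1 h2
      have := key1 b a c h.swap12 hE h1 (by convert h2 using 1; rw [zpow_natCast]; ring)
      rw [abs_of_nonneg ha]; omega
    intro x y z E a b c h hE h1 h2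
    rcases le_or_gt 0 a with ha | ha
    · exact pos a b c ha h hE h1 h2
    · obtain ⟨h', E', hE', h1', h2'⟩ := flip a _ h ha hE h1 h2
      simpa using pos (-a) b c (by omega) h' hE' h1' h2'
  have pos : ∀ {x y z E : L} (a b c : ℤ), 0 ≤ a → CubeCurve k x y z → E ≠ 0 →
      E ∈ boxSpan k x y z w w w → x ^ a * (y ^ b * z ^ c) * E ∈ boxSpan k x y z w w w →
      |a| + |b| + |c| ≤ 3 * w := by
    intro x y z E a b c ha h hE h1 h2
    obtain ⟨a, rfl⟩ := Int.eq_ofNat_of_zero_le ha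
    rw [← boxSpan_swap12, ← boxSpan_swap23] at h1 h2
    have := key2 b c a h.swap12.swap23 hE h1
      (by convert h2 using 1; rw [zpow_natCast]; ring)
    rw [abs_of_nonneg ha]; omega
  rw [mul_assoc (x ^ a)] at h2
  rcases le_or_gt 0 a with ha | ha
  · exact pos a b c ha h hE h1 h2
  · obtain ⟨h', E', hE', h1', h2'⟩ := flip a _ h ha hE h1 h2
    simpa using pos (-a) b c (by omega) h' hE' h1' h2'

end CubeRelation
-- Irreducible biquadratics and construction of the curve
section Biquadratic

open Polynomial

variable {k L : Type*} [Field k] [Field L] [Algebra k L]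

/-- The biquadratic polynomial that the determinant of two opposite faces of a cube amounts to. -/
noncomputable def biquad (a b c d : k) : k[X][X] :=
  C (C c - C d * X - C a * X ^ 2) * X ^ 2 + C (C b - C b * X ^ 2) * X +
    C (C a + C d * X - C c * X ^ 2)

/-- Conditions on the coefficients under which `biquad` is irreducible. -/
structure BiquadCond (a b c d : k) : Prop where
  lead : c ≠ 0
  no_root_left : ∀ t, a + b * t + c * t ^ 2 ≠ 0
  no_root_right : ∀ t, a + d * t - c * t ^ 2 ≠ 0
  middle : b ≠ 0 ∨ a + c ≠ 0

/-- The family is stable under exchanging the variables, so one irreducibility statement controls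
both degrees. -/
lemma swap_biquad (a b c d : k) : Bivariate.swap (biquad a b c d) = biquad a d (-c) b := by
  simp only [biquad, map_add, map_mul, map_sub, map_pow, Bivariate.swap_X, Bivariate.swap_Y,
    Bivariate.swap_C_C, map_neg]
  ring

lemma natDegree_biquad {a b c d : k} (h : c ≠ 0) : (biquad a b c d).natDegree = 2 := by
  refine natDegree_quadratic fun h0 => h ?_
  simpa using congrArg (eval 0) h0

/-- A factor depending on `x` alone divides every coefficient, which `no_root_right` and `middle`
exclude. Two factors linear in `y` would, at `x = 0`, give a root of `a + b t + c t ^ 2`. -/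
lemma irreducible_biquad {a b c d : k} (h : BiquadCond a b c d) :
    Irreducible (biquad a b c d) := by
  have hdeg := natDegree_biquad (a := a) (b := b) (d := d) h.lead
  have h0 : biquad a b c d ≠ 0 := by
    intro h0; rw [h0, natDegree_zero] at hdeg; omega
  have hc0 : (biquad a b c d).coeff 0 = C a + C d * X - C c * X ^ 2 := by
    simp only [biquad, coeff_add, coeff_C_mul, coeff_X_pow, coeff_X, coeff_C]; norm_num
  have hc1 : (biquad a b c d).coeff 1 = C b - C b * X ^ 2 := by
    simp only [biquad, coeff_add, coeff_C_mul, coeff_X_pow, coeff_X, coeff_C]; norm_num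
  have hc2 : (biquad a b c d).coeff 2 = C c - C d * X - C a * X ^ 2 := by
    simp only [biquad, coeff_add, coeff_C_mul, coeff_X_pow, coeff_X, coeff_C]; norm_num
  have hroot : ∀ g : k[X], g ∣ C a + C d * X - C c * X ^ 2 → ∀ t, g.eval t ≠ 0 := by
    rintro g ⟨q, hq⟩ t ht
    apply h.no_root_right t
    have := congrArg (eval t) hq
    simpa [ht] using this
  have hd0 : (C a + C d * X - C c * X ^ 2).natDegree = 2 := by
    have : C a + C d * X - C c * X ^ 2 = C (-c) * X ^ 2 + C d * X + C a := by
      rw [C_neg]; ring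
    rw [this]
    exact natDegree_quadratic (neg_ne_zero.2 h.lead)
  have hunit : ∀ (g : k[X]) (q : k[X][X]), biquad a b c d = C g * q → IsUnit g := by
    intro g q hgq
    have hdvd := (C_dvd_iff_dvd_coeff g (biquad a b c d)).1 ⟨q, hgq⟩
    have d0 := hdvd 0
    have d1 := hdvd 1
    have d2 := hdvd 2
    rw [hc0] at d0
    rw [hc1] at d1
    rw [hc2] at d2
    have hne : C a + C d * X - C c * X ^ 2 ≠ 0 := by
      intro hz; rw [hz, natDegree_zero] at hd0; omega
    have hg0 : g ≠ 0 := fun hg => hne (by rw [hg] at d0; exact zero_dvd_iff.1 d0)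
    have hle := natDegree_le_of_dvd d0 hne
    rw [hd0] at hle
    -- The middle coefficient is `b (1 - X ^ 2)`, and the sum of the outer two is `(a + c) (1 - X ^
    -- 2)`. A quadratic `g` dividing such a multiple would vanish at 1.
    obtain ⟨m, hm, hmd⟩ : ∃ m : k, m ≠ 0 ∧ g ∣ C m * (1 - X ^ 2) := by
      rcases h.middle with hb | hac
      · exact ⟨b, hb, by rwa [mul_sub, mul_one]⟩
      · refine ⟨a + c, hac, ?_⟩
        convert dvd_add d0 d2 using 1
        rw [C_add]; ring
    have hcase : g.natDegree = 0 ∨ g.natDegree = 1 ∨ g.natDegree = 2 := by omega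
    rcases hcase with h' | h' | h'
    · rw [natDegree_eq_zero] at h'
      obtain ⟨u, rfl⟩ := h'
      exact (isUnit_C).2 (isUnit_iff_ne_zero.2 fun hu => hg0 (by rw [hu, C_0]))
    · exfalso
      obtain ⟨t, ht⟩ := exists_root_of_degree_eq_one
        ((degree_eq_iff_natDegree_eq_of_pos one_pos).2 h')
      exact hroot g d0 t ht
    · exfalso
      obtain ⟨e, he⟩ := hmd
      have hdm : (C m * (1 - X ^ 2) : k[X]).natDegree = 2 := by
        have : (C m * (1 - X ^ 2) : k[X]) = C (-m) * X ^ 2 + C 0 * X + C m := by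
          rw [C_neg, C_0]; ring
        rw [this]
        exact natDegree_quadratic (neg_ne_zero.2 hm)
      have he0 : e ≠ 0 := by
        rintro rfl; rw [he, mul_zero, natDegree_zero] at hdm; omega
      rw [he, natDegree_mul hg0 he0, h'] at hdm
      obtain ⟨u, rfl⟩ := natDegree_eq_zero.1 (show e.natDegree = 0 by omega)
      have := congrArg (eval 1) he
      simp only [eval_mul, eval_C, eval_sub, eval_one, eval_pow, eval_X, one_pow, sub_self,
        mul_zero] at this
      rcases mul_eq_zero.1 this.symm with h1 | h1
      · exact hroot g d0 1 h1
      · exact he0 (by rw [h1, C_0])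
  refine ⟨fun hu => ?_, fun {g q} hgq => ?_⟩
  · have := natDegree_eq_zero_of_isUnit hu
    omega
  · have hg0 : g ≠ 0 := by rintro rfl; exact h0 (by rw [hgq, zero_mul])
    have hq0 : q ≠ 0 := by rintro rfl; exact h0 (by rw [hgq, mul_zero])
    have hsum := hdeg
    rw [hgq, natDegree_mul hg0 hq0] at hsum
    have hcase : g.natDegree = 0 ∨ q.natDegree = 0 ∨ (g.natDegree = 1 ∧ q.natDegree = 1) := by
      omega
    rcases hcase with h' | h' | ⟨h1, h2⟩
    · obtain ⟨u, rfl⟩ := natDegree_eq_zero.1 h'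
      exact Or.inl (isUnit_C.2 (hunit u q hgq))
    · obtain ⟨u, rfl⟩ := natDegree_eq_zero.1 h'
      exact Or.inr (isUnit_C.2 (hunit u g (by rw [hgq, mul_comm])))
    · exfalso
      have hmap : (biquad a b c d).map (evalRingHom 0) = C c * X ^ 2 + C b * X + C a := by
        simp [biquad]
      have hprod : g.map (evalRingHom 0) * q.map (evalRingHom 0) =
          C c * X ^ 2 + C b * X + C a := by rw [← Polynomial.map_mul, ← hgq, hmap]
      have hdp := natDegree_quadratic (b := b) (c := a) h.lead
      have hp0 : (C c * X ^ 2 + C b * X + C a) ≠ 0 := by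
        intro hz; rw [hz, natDegree_zero] at hdp; omega
      have hgm : g.map (evalRingHom 0) ≠ 0 := by
        intro hz; rw [hz, zero_mul] at hprod; exact hp0 hprod.symm
      have hqm : q.map (evalRingHom 0) ≠ 0 := by
        intro hz; rw [hz, mul_zero] at hprod; exact hp0 hprod.symm
      have l1 := natDegree_map_le (f := evalRingHom (0 : k)) (p := g)
      have l2 := natDegree_map_le (f := evalRingHom (0 : k)) (p := q)
      rw [← hprod, natDegree_mul hgm hqm] at hdp
      obtain ⟨t, ht⟩ := exists_root_of_degree_eq_one
        ((degree_eq_iff_natDegree_eq_of_pos one_pos).2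
          (show (g.map (evalRingHom 0)).natDegree = 1 by omega))
      have := congrArg (eval t) hprod
      rw [eval_mul, IsRoot.def.1 ht, zero_mul] at this
      apply h.no_root_left t
      simp only [eval_add, eval_mul, eval_C, eval_pow, eval_X] at this
      rw [this]; ring

/-- Over a transcendental `x`, an irreducible polynomial in two variables that vanishes at `(x, y)`
divides every other one. -/
lemma dvd_of_eval₂_eq_zero {x y : L} (hx : Transcendental k x) {f r : k[X][X]}
    (hf : Irreducible f) (hf0 : f.natDegree ≠ 0)
    (h1 : f.eval₂ (aeval x : k[X] →ₐ[k] L).toRingHom y = 0)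
    (h2 : r.eval₂ (aeval x : k[X] →ₐ[k] L).toRingHom y = 0) : f ∣ r := by
  have hinj : Function.Injective (aeval x : k[X] →ₐ[k] L).toRingHom :=
    transcendental_iff_injective.1 hx
  let φ : FractionRing k[X] →+* L := IsFractionRing.lift hinj
  have hφ : φ.comp (algebraMap k[X] (FractionRing k[X])) =
      (aeval x : k[X] →ₐ[k] L).toRingHom :=
    RingHom.ext fun t => IsFractionRing.lift_algebraMap hinj t
  have hev : ∀ p : k[X][X], (p.map (algebraMap k[X] (FractionRing k[X]))).eval₂ φ y =
      p.eval₂ (aeval x : k[X] →ₐ[k] L).toRingHom y := by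
    intro p; rw [eval₂_map, hφ]
  have hprim : f.IsPrimitive := hf.isPrimitive hf0
  have hirr := (hprim.irreducible_iff_irreducible_map_fraction_map (K := FractionRing k[X])).1 hf
  refine hprim.dvd_of_fraction_map_dvd_fraction_map (K := FractionRing k[X]) ?_
  by_contra hnd
  obtain ⟨u, v, huv⟩ := (hirr.coprime_iff_not_dvd).2 hnd
  have := congrArg (eval₂ φ y) huv
  rw [eval₂_add, eval₂_mul, eval₂_mul, hev, hev, h1, h2, mul_zero, mul_zero, add_zero,
    eval₂_one] at this
  exact zero_ne_one this

/-! ### Independence of `1` and one coordinate over polynomials in another -/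

section Slopes

variable {x y : L} {a b c d : k}

/-- `(x, y)` is a zero of `biquad a b c d`. -/
def IsBiquadZero (a b c d : k) (x y : L) : Prop :=
  (biquad a b c d).eval₂ (aeval x : k[X] →ₐ[k] L).toRingHom y = 0

lemma isBiquadZero_iff : IsBiquadZero a b c d x y ↔
    algebraMap k L a + algebraMap k L b * y + algebraMap k L c * y ^ 2 + algebraMap k L d * x -
      algebraMap k L d * x * y ^ 2 - algebraMap k L c * x ^ 2 - algebraMap k L b * x ^ 2 * y -
      algebraMap k L a * x ^ 2 * y ^ 2 = 0 := by
  have : (biquad a b c d).eval₂ (aeval x : k[X] →ₐ[k] L).toRingHom y =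
    algebraMap k L a + algebraMap k L b * y + algebraMap k L c * y ^ 2 + algebraMap k L d * x -
      algebraMap k L d * x * y ^ 2 - algebraMap k L c * x ^ 2 - algebraMap k L b * x ^ 2 * y -
      algebraMap k L a * x ^ 2 * y ^ 2 := by
    simp [biquad, eval₂_add, eval₂_mul, eval₂_sub, eval₂_pow]
    ring
  rw [IsBiquadZero, this]

/-- The irreducible polynomial of `y` over `x` has degree 2 in `y`, so it divides no nonzero
polynomial of degree at most 1 in `y`. -/
lemma eq_zero_of_linear_right (hx : Transcendental k x) (h : BiquadCond a b c d)
    (h0 : IsBiquadZero a b c d x y) (p q : k[X]) (hpq : aeval x p + aeval x q * y = 0) :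
    p = 0 ∧ q = 0 := by
  have hdeg := natDegree_biquad (a := a) (b := b) (d := d) h.lead
  have hdvd := dvd_of_eval₂_eq_zero (r := C q * X + C p) hx (irreducible_biquad h)
    (by omega) h0 (by simp; rw [← hpq]; ring)
  have hz : C q * X + C p = 0 := by
    by_contra hne
    have := natDegree_le_of_dvd hdvd hne
    have := natDegree_linear_le (a := q) (b := p)
    omega
  have e0 := congrArg (fun t => coeff t 0) hz
  have e1 := congrArg (fun t => coeff t 1) hz
  simp at e0 e1
  exact ⟨e0, e1⟩

/-- The same divisibility is read after exchanging the variables; the degree in `x` is 2 as well.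
This avoids showing that `y` is transcendental. -/
lemma eq_zero_of_linear_left (hx : Transcendental k x) (h : BiquadCond a b c d)
    (h0 : IsBiquadZero a b c d x y) (p q : k[X]) (hpq : aeval y p + aeval y q * x = 0) :
    p = 0 ∧ q = 0 := by
  have hdeg := natDegree_biquad (a := a) (b := d) (d := b) (neg_ne_zero.2 h.lead)
  have hdeg' := natDegree_biquad (a := a) (b := b) (d := d) h.lead
  have hdvd := dvd_of_eval₂_eq_zero (r := q.map C * C X + p.map C) hx (irreducible_biquad h)
    (by omega) h0 (by
      have hC : ((aeval x : k[X] →ₐ[k] L).toRingHom).comp C = algebraMap k L := by ext; simp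
      rw [eval₂_add, eval₂_mul, eval₂_map, eval₂_map, hC, eval₂_C, ← aeval_def, ← aeval_def]
      simp only [AlgHom.toRingHom_eq_coe, RingHom.coe_coe, aeval_X]
      rw [← hpq]; ring)
  have hdvd' := map_dvd Bivariate.swap hdvd
  rw [swap_biquad, map_add, map_mul, Bivariate.swap_map_C, Bivariate.swap_map_C,
    Bivariate.swap_X] at hdvd'
  have hz : C q * X + C p = 0 := by
    by_contra hne
    have := natDegree_le_of_dvd hdvd' hne
    have := natDegree_linear_le (a := q) (b := p)
    omega
  have e0 := congrArg (fun t => coeff t 0) hz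
  have e1 := congrArg (fun t => coeff t 1) hz
  simp at e0 e1
  exact ⟨e0, e1⟩

lemma two_mul_le_finrank_boxSpan {x y z : L}
    (h : ∀ p q : k[X], aeval x p + aeval x q * y = 0 → p = 0 ∧ q = 0) (n : ℕ) :
    2 * (n + 1) ≤ Module.finrank k (boxSpan k x y z n 1 0) := by
  let g : (degreeLT k (n + 1) × degreeLT k (n + 1)) →ₗ[k] L :=
    ((aeval x : k[X] →ₐ[k] L).toLinearMap ∘ₗ (degreeLT k (n + 1)).subtype).coprod
      (LinearMap.mulRight k y ∘ₗ (aeval x : k[X] →ₐ[k] L).toLinearMap ∘ₗ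
        (degreeLT k (n + 1)).subtype)
  have hg : Function.Injective g := by
    rw [← LinearMap.ker_eq_bot, LinearMap.ker_eq_bot']
    rintro ⟨p, q⟩ hpq
    obtain ⟨h1, h2⟩ := h p.1 q.1 (by simpa [g] using hpq)
    ext1
    · exact Subtype.ext h1
    · exact Subtype.ext h2
  have hpow : ∀ p ∈ degreeLT k (n + 1), ∀ j ≤ 1, aeval x p * y ^ j ∈ boxSpan k x y z n 1 0 := by
    intro p hp j hj
    rw [mem_degreeLT] at hp
    rw [aeval_eq_sum_range' (n := n + 1) (by
      rcases eq_or_ne p 0 with rfl | h0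
      · simp
      · exact (natDegree_lt_iff_degree_lt h0).2 hp), Finset.sum_mul]
    refine Submodule.sum_mem _ fun i hi => ?_
    rw [smul_mul_assoc]
    refine Submodule.smul_mem _ _ ?_
    have := mem_boxSpan (k := k) (x := x) (y := y) (z := z) (Finset.mem_range_succ_iff.1 hi) hj
      (le_refl 0)
    simpa using this
  have hle : LinearMap.range g ≤ boxSpan k x y z n 1 0 := by
    rintro _ ⟨⟨p, q⟩, rfl⟩
    have h1 := hpow p.1 p.2 0 (by omega)
    have h2 := hpow q.1 q.2 1 (by omega)
    simpa [g] using add_mem h1 h2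
  have := Submodule.finrank_mono hle
  rw [LinearMap.finrank_range_of_inj hg, Module.finrank_prod,
    (degreeLTEquiv k (n + 1)).finrank_eq, Module.finrank_fin_fun] at this
  omega

end Slopes

lemma exists_isBiquadZero [IsAlgClosed L] {x : L} (hx : Transcendental k x) {a b c d : k}
    (hc : c ≠ 0) : ∃ y : L, IsBiquadZero a b c d x y := by
  have hinj : Function.Injective (aeval x : k[X] →ₐ[k] L).toRingHom :=
    transcendental_iff_injective.1 hx
  have hdeg : ((biquad a b c d).map (aeval x : k[X] →ₐ[k] L).toRingHom).natDegree = 2 := by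
    rw [natDegree_map_eq_of_injective hinj, natDegree_biquad hc]
  obtain ⟨y, hy⟩ := IsAlgClosed.exists_root
    ((biquad a b c d).map (aeval x : k[X] →ₐ[k] L).toRingHom)
    (fun h0 => absurd hdeg (by rw [natDegree_eq_of_degree_eq_some (n := 0) h0]; decide))
  exact ⟨y, by rwa [IsRoot.def, eval_map] at hy⟩

/-- The determinant of two pairs. -/
def cross (u w : k × k) : k := u.1 * w.2 - u.2 * w.1

/-- Existence of the curve attached to a family of corner vectors. -/
theorem exists_cubeCurve [IsAlgClosed L] {x : L} (hx : Transcendental k x)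
    (v : Bool × Bool × Bool → k × k) (s : k) (hs : s * s = 1)
    (hanti : ∀ e, v (antipode e) = s • v e)
    (hv : ∀ e d, e ≠ d → e ≠ antipode d → cross (v e) (v d) ≠ 0)
    (h1 : BiquadCond (cross (v (false, false, false)) (v (false, false, true)))
      (cross (v (false, false, false)) (v (false, true, true)) +
        cross (v (false, true, false)) (v (false, false, true)))
      (cross (v (false, true, false)) (v (false, true, true)))
      (s * (cross (v (false, false, false)) (v (false, true, false)) +
        cross (v (false, true, true)) (v (false, false, true)))))
    (h2 : BiquadCond (cross (v (false, false, false)) (v (false, true, false)))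
      (cross (v (false, false, false)) (v (false, true, true)) +
        cross (v (false, false, true)) (v (false, true, false)))
      (cross (v (false, false, true)) (v (false, true, true)))
      (s * (cross (v (false, false, false)) (v (false, false, true)) +
        cross (v (false, true, true)) (v (false, true, false))))) :
    ∃ y z : L, CubeCurve k x y z ∧ ∑ e, (v e).1 • cubeMon x y z e = 0 ∧
      ∑ e, (v e).2 • cubeMon x y z e = 0 := by
  have v111 := hanti (false, false, false)
  have v110 := hanti (false, false, true)
  have v101 := hanti (false, true, false)
  have v100 := hanti (false, true, true)
  simp only [antipode, Bool.not_false, Bool.not_true] at v111 v110 v101 v100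
  have hne := hv (false, false, false) (false, false, true) (by decide) (by decide)
  have hsum : ∀ (w : Bool × Bool × Bool → k) (y z : L), ∑ e, w e • cubeMon x y z e =
      algebraMap k L (w (true, true, true)) * (x * y * z) +
      algebraMap k L (w (true, true, false)) * (x * y) +
      algebraMap k L (w (true, false, true)) * (x * z) +
      algebraMap k L (w (true, false, false)) * x +
      algebraMap k L (w (false, true, true)) * (y * z) +
      algebraMap k L (w (false, true, false)) * y +
      algebraMap k L (w (false, false, true)) * z +
      algebraMap k L (w (false, false, false)) := by
    intro w y z
    simp only [Fintype.sum_prod_type, Fintype.sum_bool, cubeMon, Algebra.smul_def]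
    simp
    ring
  suffices hmain : ∃ y z : L, z ≠ 0 ∧ y ≠ 0 ∧
      (∀ p q : k[X], aeval x p + aeval x q * y = 0 → p = 0 ∧ q = 0) ∧
      (∀ p q : k[X], aeval y p + aeval y q * x = 0 → p = 0 ∧ q = 0) ∧
      (∀ p q : k[X], aeval z p + aeval z q * x = 0 → p = 0 ∧ q = 0) ∧
      ∑ e, (v e).1 • cubeMon x y z e = 0 ∧ ∑ e, (v e).2 • cubeMon x y z e = 0 by
    obtain ⟨y, z, hz, hy, s1, s2, s3, e1, e2⟩ := hmain
    exact ⟨y, z, CubeCurve.of_slopes (fun h0 => hx (h0 ▸ isAlgebraic_zero)) hy hz (CubeRule.of_relation v hv e1 e2)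
      (two_mul_le_finrank_boxSpan s1) (two_mul_le_finrank_boxSpan s2)
      (two_mul_le_finrank_boxSpan s3), e1, e2⟩
  simp only [hsum, v111, v110, v101, v100, Prod.smul_fst, Prod.smul_snd, smul_eq_mul, map_mul]
  generalize v (false, false, false) = γ at *
  generalize v (false, false, true) = β at *
  generalize v (false, true, false) = δ at *
  generalize v (false, true, true) = α at *
  have hs' : algebraMap k L s * algebraMap k L s = 1 := by rw [← map_mul, hs, map_one]
  have hs0 : s ≠ 0 := by rintro rfl; simp at hs
  -- Both relations are affine in `z`; the determinant of their constant and linear parts is this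
  -- biquadratic in `x, y`. So `y` is chosen as its root, and `z` then solves the first relation.
  obtain ⟨y, hy⟩ := exists_isBiquadZero (L := L) hx h1.lead
  have hslope1 := eq_zero_of_linear_right hx h1 hy
  have hslope2 := eq_zero_of_linear_left hx h1 hy
  -- If this denominator vanished, independence of `1, y` would give `β.1 = γ.1 = 0`, making `cross
  -- γ β` zero.
  have hden : algebraMap k L β.1 + algebraMap k L α.1 * y + algebraMap k L s *
      (algebraMap k L δ.1 * x + algebraMap k L γ.1 * (x * y)) ≠ 0 := by
    intro h0
    obtain ⟨e1, e2⟩ := hslope1 (C β.1 + C (s * δ.1) * X) (C α.1 + C (s * γ.1) * X)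
      (by simp; rw [← h0]; ring)
    have e3 := congrArg (fun t => coeff t 0) e1
    have e4 := congrArg (fun t => coeff t 1) e2
    simp [hs0] at e3 e4
    apply hne
    rw [cross, e3, e4]; ring
  rw [isBiquadZero_iff] at hy
  set z : L := -(algebraMap k L γ.1 + algebraMap k L δ.1 * y + algebraMap k L s *
      (algebraMap k L α.1 * x + algebraMap k L β.1 * (x * y))) /
    (algebraMap k L β.1 + algebraMap k L α.1 * y + algebraMap k L s *
      (algebraMap k L δ.1 * x + algebraMap k L γ.1 * (x * y))) with hzdef
  have hz1 := (eq_div_iff hden).1 hzdef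
  simp only [cross, map_sub, map_add, map_mul] at hy
  have r1 : algebraMap k L s * algebraMap k L γ.1 * (x * y * z) +
      algebraMap k L s * algebraMap k L β.1 * (x * y) +
      algebraMap k L s * algebraMap k L δ.1 * (x * z) + algebraMap k L s * algebraMap k L α.1 * x +
      algebraMap k L α.1 * (y * z) + algebraMap k L δ.1 * y + algebraMap k L β.1 * z +
      algebraMap k L γ.1 = 0 := by linear_combination hz1
  have r2 : algebraMap k L s * algebraMap k L γ.2 * (x * y * z) +
      algebraMap k L s * algebraMap k L β.2 * (x * y) +
      algebraMap k L s * algebraMap k L δ.2 * (x * z) + algebraMap k L s * algebraMap k L α.2 * x +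
      algebraMap k L α.2 * (y * z) + algebraMap k L δ.2 * y + algebraMap k L β.2 * z +
      algebraMap k L γ.2 = 0 := by
    rw [← mul_left_inj' hden, zero_mul]
    generalize algebraMap k L s = s at *
    linear_combination (s * algebraMap k L γ.2 * (x * y) + s * algebraMap k L δ.2 * x +
      algebraMap k L α.2 * y + algebraMap k L β.2) * hz1 - hy + x ^ 2 *
      (algebraMap k L δ.1 * algebraMap k L α.2 - algebraMap k L δ.2 * algebraMap k L α.1 +
      (algebraMap k L γ.1 * algebraMap k L α.2 - algebraMap k L γ.2 * algebraMap k L α.1 +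
        algebraMap k L δ.1 * algebraMap k L β.2 - algebraMap k L δ.2 * algebraMap k L β.1) * y +
      (algebraMap k L γ.1 * algebraMap k L β.2 - algebraMap k L γ.2 * algebraMap k L β.1) *
        y ^ 2) * hs'
  -- Eliminating `y` instead of `z` exchanges `β` and `δ`, and gives the slope in the `z` direction.
  have hg : IsBiquadZero (cross γ δ) (cross γ α + cross β δ) (cross β α)
      (s * (cross γ β + cross α δ)) x z := by
    rw [isBiquadZero_iff]
    simp only [cross, map_sub, map_add, map_mul]
    generalize algebraMap k L s = s at *
    linear_combination (algebraMap k L δ.2 + algebraMap k L α.2 * z + s * algebraMap k L β.2 * x +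
        s * algebraMap k L γ.2 * x * z) * r1 -
      (algebraMap k L δ.1 + algebraMap k L α.1 * z + s * algebraMap k L β.1 * x +
        s * algebraMap k L γ.1 * x * z) * r2 + x ^ 2 *
      (algebraMap k L β.1 * algebraMap k L α.2 - algebraMap k L β.2 * algebraMap k L α.1 +
      (algebraMap k L γ.1 * algebraMap k L α.2 - algebraMap k L γ.2 * algebraMap k L α.1 +
        algebraMap k L β.1 * algebraMap k L δ.2 - algebraMap k L β.2 * algebraMap k L δ.1) * z +
      (algebraMap k L γ.1 * algebraMap k L δ.2 - algebraMap k L γ.2 * algebraMap k L δ.1) *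
        z ^ 2) * hs'
  have hslope3 := eq_zero_of_linear_left hx h2 hg
  refine ⟨y, z, ?_, ?_, hslope1, hslope2, hslope3, r1, r2⟩
  · intro h0
    exact X_ne_zero (hslope3 X 0 (by simp [h0])).1
  · intro h0
    exact X_ne_zero (hslope2 X 0 (by simp [h0])).1

end Biquadratic
-- Generators, syndromes and charges
section Syndrome

variable {k : Type*} [Field k]

/-- The site of a corner of the unit cube. -/
def cornerSite (e : Bool × Bool × Bool) : Site :=
  ![if e.1 then 1 else 0, if e.2.1 then 1 else 0, if e.2.2 then 1 else 0]

@[simp] lemma cornerSite_zero (e : Bool × Bool × Bool) :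
    cornerSite e 0 = if e.1 then 1 else 0 := rfl

@[simp] lemma cornerSite_one (e : Bool × Bool × Bool) :
    cornerSite e 1 = if e.2.1 then 1 else 0 := rfl

@[simp] lemma cornerSite_two (e : Bool × Bool × Bool) :
    cornerSite e 2 = if e.2.2 then 1 else 0 := rfl

lemma cornerSite_antipode (e : Bool × Bool × Bool) :
    cornerSite (antipode e) = 1 - cornerSite e := by
  revert e; decide

lemma antipode_antipode (e : Bool × Bool × Bool) : antipode (antipode e) = e := by
  simp [antipode]

/-- The map `cross` as a linear map in its second argument. -/
def crossMap (u : k × k) : k × k →ₗ[k] k :=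
  u.1 • LinearMap.snd k k k - u.2 • LinearMap.fst k k k

@[simp] lemma crossMap_apply (u w : k × k) : crossMap u w = cross u w := rfl

lemma eq_zero_of_cross {a b w : k × k} (hab : cross a b ≠ 0) (ha : cross a w = 0)
    (hb : cross b w = 0) : w = 0 := by
  simp only [cross] at *
  ext
  · apply (mul_eq_zero.1 (show (a.1 * b.2 - a.2 * b.1) * w.1 = 0 by
      linear_combination b.1 * ha - a.1 * hb)).resolve_left hab
  · apply (mul_eq_zero.1 (show (a.1 * b.2 - a.2 * b.1) * w.2 = 0 by
      linear_combination b.2 * ha - a.2 * hb)).resolve_left hab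

/-- The pairs of the generator at the unit cube with lowest corner `c`. -/
noncomputable def genPairs (v : Bool × Bool × Bool → k × k) (c : Site) : Site →₀ k × k :=
  ∑ e, Finsupp.single (c + cornerSite e) (v e)

/-- Linear combinations of generators. -/
noncomputable def genMap (v : Bool × Bool × Bool → k × k) : (Site →₀ k) →ₗ[k] (Site →₀ k × k) :=
  Finsupp.linearCombination k (genPairs v)

/-- The commutator of an operator with all the generators. -/
noncomputable def syndrome (v : Bool × Bool × Bool → k × k) :
    (Site →₀ k × k) →ₗ[k] (Site →₀ k) :=
  Finsupp.lsum k fun s => ∑ e, Finsupp.lsingle (s - cornerSite e) ∘ₗ crossMap (v e)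

lemma syndrome_single (v : Bool × Bool × Bool → k × k) (s : Site) (a : k × k) :
    syndrome v (Finsupp.single s a) =
      ∑ e, Finsupp.single (s - cornerSite e) (cross (v e) a) := by
  rw [syndrome, Finsupp.lsum_single, LinearMap.sum_apply]
  rfl

lemma syndrome_apply (v : Bool × Bool × Bool → k × k) (u : Site →₀ k × k) (c : Site) :
    syndrome v u c = ∑ e, cross (v e) (u (c + cornerSite e)) := by
  induction u using Finsupp.induction_linear with
  | zero => simp [cross]
  | add u w hu hw =>
    rw [map_add, Finsupp.add_apply, hu, hw, ← Finset.sum_add_distrib]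
    refine Finset.sum_congr rfl fun e _ => ?_
    simp only [← crossMap_apply, Finsupp.add_apply, map_add]
  | single s a =>
    rw [syndrome_single, Finsupp.finsetSum_apply]
    refine Finset.sum_congr rfl fun e _ => ?_
    by_cases h : s = c + cornerSite e
    · subst h; simp
    · rw [Finsupp.single_eq_of_ne (by rintro rfl; apply h; simp),
        Finsupp.single_eq_of_ne (Ne.symm h)]
      simp [cross]

lemma genMap_apply (v : Bool × Bool × Bool → k × k) (h : Site →₀ k) (s : Site) :
    genMap v h s = ∑ e, h (s - cornerSite e) • v e := by
  induction h using Finsupp.induction_linear with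
  | zero => simp
  | add u w hu hw =>
    rw [map_add, Finsupp.add_apply, hu, hw, ← Finset.sum_add_distrib]
    refine Finset.sum_congr rfl fun e _ => ?_
    rw [Finsupp.add_apply, add_smul]
  | single c a =>
    rw [genMap, Finsupp.linearCombination_single, Finsupp.smul_apply, genPairs,
      Finsupp.finsetSum_apply, Finset.smul_sum]
    refine Finset.sum_congr rfl fun e _ => ?_
    by_cases h : c = s - cornerSite e
    · subst h; simp
    · rw [Finsupp.single_eq_of_ne (by rintro rfl; apply h; simp),
        Finsupp.single_eq_of_ne (Ne.symm h)]
      simp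

/-- Generators commute. For two cubes, point inversion exchanging them matches the coinciding corner
pairs `(e, d)` and `(antipode d, antipode e)`; the determinant picks up `s * s = 1` and a sign, so
the sum equals its own negative. -/
lemma syndrome_genMap (h2 : (2 : k) ≠ 0) {v : Bool × Bool × Bool → k × k} {s : k}
    (hs : s * s = 1) (hanti : ∀ e, v (antipode e) = s • v e) (h : Site →₀ k) :
    syndrome v (genMap v h) = 0 := by
  induction h using Finsupp.induction_linear with
  | zero => simp
  | add u w hu hw => rw [map_add, map_add, hu, hw, add_zero]
  | single c a =>
    rw [genMap, Finsupp.linearCombination_single, map_smul]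
    suffices hz : syndrome v (genPairs v c) = 0 by rw [hz, smul_zero]
    ext c'
    rw [syndrome_apply, Finsupp.zero_apply]
    have hT : ∑ e, cross (v e) (genPairs v c (c' + cornerSite e)) =
        ∑ x : (Bool × Bool × Bool) × (Bool × Bool × Bool),
        if c + cornerSite x.2 = c' + cornerSite x.1 then cross (v x.1) (v x.2) else 0 := by
      refine Eq.trans ?_ (Fintype.sum_prod_type _).symm
      refine Finset.sum_congr rfl fun e _ => ?_
      rw [genPairs, Finsupp.finsetSum_apply, ← crossMap_apply, map_sum]
      refine Finset.sum_congr rfl fun d _ => ?_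
      rw [Finsupp.single_apply]
      split_ifs <;> simp [cross]
    have hneg : ∑ e, cross (v e) (genPairs v c (c' + cornerSite e)) =
        -∑ e, cross (v e) (genPairs v c (c' + cornerSite e)) := by
      conv_lhs => rw [hT]
      rw [hT, ← Finset.sum_neg_distrib]
      refine Fintype.sum_equiv
        ⟨fun x => (antipode x.2, antipode x.1), fun x => (antipode x.2, antipode x.1),
          fun x => by simp [antipode_antipode], fun x => by simp [antipode_antipode]⟩ _ _ ?_
      rintro ⟨e, d⟩
      simp only [Equiv.coe_fn_mk, cornerSite_antipode, hanti]
      have hiff : c + cornerSite d = c' + cornerSite e ↔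
          c + (1 - cornerSite e) = c' + (1 - cornerSite d) := by
        constructor <;> intro h
        · rw [eq_sub_of_add_eq h]; abel
        · have := eq_sub_of_add_eq h
          rw [this]; abel
      by_cases hc : c + cornerSite d = c' + cornerSite e
      · rw [if_pos hc, if_pos (hiff.1 hc)]
        simp only [cross, Prod.smul_fst, Prod.smul_snd, smul_eq_mul]
        linear_combination -((v e).1 * (v d).2 - (v e).2 * (v d).1) * hs
      · rw [if_neg hc, if_neg (fun h => hc (hiff.2 h)), neg_zero]
    have := eq_neg_iff_add_eq_zero.1 hneg
    rw [← two_mul] at this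
    exact (mul_eq_zero.1 this).resolve_left h2

/-- Evaluation of the syndromes at a point with nonzero coordinates. -/
noncomputable def evalMap (k : Type*) {L : Type*} [Field k] [Field L] [Algebra k L] (x y z : L) :
    (Site →₀ k) →ₗ[k] L :=
  Finsupp.linearCombination k fun s : Site => x ^ s 0 * y ^ s 1 * z ^ s 2

section Eval

variable {L : Type*} [Field L] [Algebra k L] {x y z : L}

lemma siteMon_add (hx : x ≠ 0) (hy : y ≠ 0) (hz : z ≠ 0) (s t : Site) :
    x ^ (s + t) 0 * y ^ (s + t) 1 * z ^ (s + t) 2 =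
      (x ^ s 0 * y ^ s 1 * z ^ s 2) * (x ^ t 0 * y ^ t 1 * z ^ t 2) := by
  simp only [Pi.add_apply, zpow_add₀ hx, zpow_add₀ hy, zpow_add₀ hz]; ring

lemma siteMon_corner (e : Bool × Bool × Bool) :
    x ^ cornerSite e 0 * y ^ cornerSite e 1 * z ^ cornerSite e 2 = cubeMon x y z e := by
  rcases e with ⟨_ | _, _ | _, _ | _⟩ <;> simp [cubeMon]

/-- A single-site operator violates generators placed on the inverted cube. By the symmetry under
`antipode` their charge is a combination of the two defining equations of the curve. -/
lemma evalMap_syndrome (hx : x ≠ 0) (hy : y ≠ 0) (hz : z ≠ 0)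
    {v : Bool × Bool × Bool → k × k} {s : k} (hanti : ∀ e, v (antipode e) = s • v e)
    (h1 : ∑ e, (v e).1 • cubeMon x y z e = 0) (h2 : ∑ e, (v e).2 • cubeMon x y z e = 0)
    (u : Site →₀ k × k) : evalMap k x y z (syndrome v u) = 0 := by
  induction u using Finsupp.induction_linear with
  | zero => simp
  | add u w hu hw => rw [map_add, map_add, hu, hw, add_zero]
  | single t a =>
    rw [syndrome_single, map_sum]
    have key : ∀ e, evalMap k x y z (Finsupp.single (t - cornerSite e) (cross (v e) a)) =
        (x ^ (t - 1) 0 * y ^ (t - 1) 1 * z ^ (t - 1) 2) *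
          (cross (v e) a • cubeMon x y z (antipode e)) := by
      intro e
      rw [evalMap, Finsupp.linearCombination_single, ← siteMon_corner, mul_smul_comm,
        ← siteMon_add hx hy hz, cornerSite_antipode]
      congr 3 <;> simp
    simp only [key, ← Finset.mul_sum]
    suffices hz : ∑ e, cross (v e) a • cubeMon x y z (antipode e) = 0 by rw [hz, mul_zero]
    have hreindex : ∑ e, cross (v e) a • cubeMon x y z (antipode e) =
        ∑ e, cross (v (antipode e)) a • cubeMon x y z e := by
      refine Fintype.sum_equiv ⟨antipode, antipode, antipode_antipode, antipode_antipode⟩ _ _ ?_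
      intro e
      simp [antipode_antipode]
    rw [hreindex]
    have : ∀ e, cross (v (antipode e)) a • cubeMon x y z e =
        (s * a.2) • ((v e).1 • cubeMon x y z e) - (s * a.1) • ((v e).2 • cubeMon x y z e) := by
      intro e
      rw [hanti, smul_smul, smul_smul, ← sub_smul]
      congr 1
      simp [cross]; ring
    simp only [this, Finset.sum_sub_distrib, ← Finset.smul_sum, h1, h2, smul_zero, sub_zero]

end Eval

end Syndrome
-- Dimension counts on cubes
section Counting

variable {k : Type*} [Field k]

/-- The finite set of sites of a cube. -/
noncomputable def cubeFinset (w : ℕ) (q : Site) : Finset Site :=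
  Fintype.piFinset fun i => Finset.Ico (q i) (q i + w)

lemma coe_cubeFinset (w : ℕ) (q : Site) : (cubeFinset w q : Set Site) = cube w q := by
  ext s; simp [cubeFinset, cube]

lemma card_cubeFinset (w : ℕ) (q : Site) : (cubeFinset w q).card = w ^ 3 := by
  simp [cubeFinset, Fintype.card_piFinset]

/-- The functions on the sites that vanish off a cube. -/
noncomputable abbrev onCube (k M : Type*) [Field k] [AddCommGroup M] [Module k M] (w : ℕ)
    (q : Site) : Submodule k (Site →₀ M) := Finsupp.supported M k (cube w q)

lemma finrank_onCube (M : Type*) [AddCommGroup M] [Module k M] [FiniteDimensional k M] (w : ℕ)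
    (q : Site) : Module.finrank k (onCube k M w q) = w ^ 3 * Module.finrank k M := by
  rw [onCube, ← coe_cubeFinset, (Finsupp.supportedEquivFinsupp _).finrank_eq,
    (Finsupp.linearEquivFunOnFinite k M _).finrank_eq, Module.finrank_pi_fintype]
  simp [card_cubeFinset]

instance finiteDimensional_onCube (M : Type*) [AddCommGroup M] [Module k M]
    [FiniteDimensional k M] (w : ℕ) (q : Site) : FiniteDimensional k (onCube k M w q) := by
  rw [onCube, ← coe_cubeFinset]
  exact Module.Finite.equiv (Finsupp.supportedEquivFinsupp
    (M := M) (R := k) ((cubeFinset w q : Finset Site) : Set Site)).symm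

lemma mem_onCube {M : Type*} [AddCommGroup M] [Module k M] {w : ℕ} {q : Site} {u : Site →₀ M} :
    u ∈ onCube k M w q ↔ ∀ s, s ∉ cube w q → u s = 0 := by
  rw [onCube, Finsupp.mem_supported]
  constructor
  · intro h s hs
    by_contra h0
    exact hs (h (Finsupp.mem_support_iff.2 h0))
  · intro h s hs
    by_contra h0
    exact Finsupp.mem_support_iff.1 hs (h s h0)

lemma finrank_map_add_finrank_inf_ker {V W : Type*} [AddCommGroup V] [Module k V]
    [AddCommGroup W] [Module k W] (f : V →ₗ[k] W) (A : Submodule k V) [FiniteDimensional k A] :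
    Module.finrank k (A.map f) + Module.finrank k (A ⊓ LinearMap.ker f : Submodule k V) =
      Module.finrank k A := by
  rw [← LinearMap.finrank_range_add_finrank_ker (f.domRestrict A), LinearMap.range_domRestrict,
    LinearMap.ker_domRestrict, ← Submodule.map_comap_subtype, Submodule.finrank_map_subtype_eq]

variable {v : Bool × Bool × Bool → k × k}
  (hv : ∀ e d, e ≠ d → e ≠ antipode d → cross (v e) (v d) ≠ 0)

lemma cross_eq_zero_of_syndrome {u : Site →₀ k × k} (hu : syndrome v u = 0) (s : Site)
    (e : Bool × Bool × Bool) (h : ∀ d, d ≠ e → u (s - cornerSite e + cornerSite d) = 0) :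
    cross (v e) (u s) = 0 := by
  have h1 := DFunLike.congr_fun hu (s - cornerSite e)
  rw [syndrome_apply, Finset.sum_eq_single e] at h1
  · simpa using h1
  · intro d _ hd
    rw [h d hd]; simp [cross]
  · simp

include hv in
-- Sweep the cube by increasing coordinate sum: at each site two independent determinants vanish,
-- once all earlier sites are known to be trivial.
lemma eq_zero_of_syndrome_of_cross {w : ℕ} {q : Site} {u : Site →₀ k × k}
    (hu : u ∈ onCube k (k × k) w q) (hsyn : syndrome v u = 0)
    (hcr : ∀ s ∈ cube (w - 1) q, cross (v (false, true, true)) (u s) = 0) : u = 0 := by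
  rw [mem_onCube] at hu
  have main : ∀ N : ℕ, ∀ s : Site, s 0 + s 1 + s 2 < q 0 + q 1 + q 2 + N → u s = 0 := by
    intro N
    induction N with
    | zero =>
      intro s hs
      refine hu s fun hc => ?_
      have h0 := hc 0
      have h1 := hc 1
      have h2 := hc 2
      push_cast at hs
      omega
    | succ N ih =>
      intro s hs
      by_cases hc : s ∈ cube w q
      swap
      · exact hu s hc
      have c0 := hc 0
      have c1 := hc 1
      have c2 := hc 2
      push_cast at hs
      -- The generator whose last corner is at `s` meets only earlier sites otherwise.
      have e111 : cross (v (true, true, true)) (u s) = 0 := by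
        refine cross_eq_zero_of_syndrome hsyn s _ ?_
        rintro ⟨_ | _, _ | _, _ | _⟩ hd <;> simp at hd <;>
        · refine ih _ ?_
          simp
          omega
      by_cases hin : s ∈ cube (w - 1) q
      · exact eq_zero_of_cross (hv _ _ (by decide) (by decide)) (hcr s hin) e111
      · have : s 0 = q 0 + w - 1 ∨ s 1 = q 1 + w - 1 ∨ s 2 = q 2 + w - 1 := by
          by_contra hcon
          refine hin fun i => ?_
          fin_cases i <;> simp <;> omega
        rcases this with h | h | h
        -- On an upper face a second generator is available: half of its corners stick out of the
        -- cube, the other half are `s` and earlier sites.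
        · refine eq_zero_of_cross (hv (false, true, true) _ (by decide) (by decide)) ?_ e111
          refine cross_eq_zero_of_syndrome hsyn s _ ?_
          rintro ⟨_ | _, b, c⟩ hd
          · refine ih _ ?_
            rcases b with _ | _ <;> rcases c with _ | _ <;> simp at hd <;> simp <;>
              omega
          · refine hu _ fun hc' => ?_
            have := hc' 0
            simp at this
            omega
        · refine eq_zero_of_cross (hv (true, false, true) _ (by decide) (by decide)) ?_ e111
          refine cross_eq_zero_of_syndrome hsyn s _ ?_
          rintro ⟨b, _ | _, c⟩ hd
          · refine ih _ ?_
            rcases b with _ | _ <;> rcases c with _ | _ <;> simp at hd <;> simp <;>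
              omega
          · refine hu _ fun hc' => ?_
            have := hc' 1
            simp at this
            omega
        · refine eq_zero_of_cross (hv (true, true, false) _ (by decide) (by decide)) ?_ e111
          refine cross_eq_zero_of_syndrome hsyn s _ ?_
          rintro ⟨b, c, _ | _⟩ hd
          · refine ih _ ?_
            rcases b with _ | _ <;> rcases c with _ | _ <;> simp at hd <;> simp <;>
              omega
          · refine hu _ fun hc' => ?_
            have := hc' 2
            simp at this
            omega
  ext1 s
  exact main ((s 0 + s 1 + s 2 - (q 0 + q 1 + q 2)).toNat + 1) s (by push_cast; omega)

include hv in
lemma finrank_onCube_inf_ker_le (w : ℕ) (q : Site) :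
    Module.finrank k (onCube k (k × k) w q ⊓ LinearMap.ker (syndrome v) :
      Submodule k (Site →₀ k × k)) ≤ (w - 1) ^ 3 := by
  set A : Submodule k (Site →₀ k × k) := onCube k (k × k) w q ⊓ LinearMap.ker (syndrome v) with hA
  have hfd : FiniteDimensional k A := Submodule.finiteDimensional_inf_left _ _
  let f : (Site →₀ k × k) →ₗ[k] (cubeFinset (w - 1) q → k) :=
    LinearMap.pi fun s => crossMap (v (false, true, true)) ∘ₗ Finsupp.lapply s.1
  have hf : A ⊓ LinearMap.ker f = ⊥ := by
    rw [eq_bot_iff]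
    rintro u ⟨hu, h⟩
    refine eq_zero_of_syndrome_of_cross hv hu.1 hu.2 fun s hs => ?_
    rw [← coe_cubeFinset] at hs
    exact congrFun (LinearMap.mem_ker.1 h) ⟨s, hs⟩
  have h1 := finrank_map_add_finrank_inf_ker f A
  rw [hf, finrank_bot, add_zero] at h1
  have h2 := Submodule.finrank_le (A.map f)
  rwa [h1, Module.finrank_fintype_fun_eq_card, Fintype.card_coe, card_cubeFinset] at h2

include hv in
-- At a generator of minimal coordinate sum, the lowest corner is touched by no other generator in
-- the combination.
lemma genMap_injective : Function.Injective (genMap v) := by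
  rw [← LinearMap.ker_eq_bot, LinearMap.ker_eq_bot']
  intro h hh
  by_contra h0
  obtain ⟨c, hc, hmin⟩ := Finset.exists_min_image h.support (fun s => s 0 + s 1 + s 2)
    (Finsupp.support_nonempty_iff.2 h0)
  have h1 := DFunLike.congr_fun hh c
  rw [genMap_apply, Finset.sum_eq_single (false, false, false)] at h1
  · have hz : c - cornerSite (false, false, false) = c := by
      ext i; fin_cases i <;> simp
    rw [hz, Finsupp.zero_apply] at h1
    rcases smul_eq_zero.1 h1 with h1 | h1
    · exact Finsupp.mem_support_iff.1 hc h1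
    · apply hv (false, false, false) (false, false, true) (by decide) (by decide)
      simp [cross, h1]
  · rintro e - he
    have : h (c - cornerSite e) = 0 := by
      by_contra hne
      have := hmin _ (Finsupp.mem_support_iff.2 hne)
      rcases e with ⟨_ | _, _ | _, _ | _⟩ <;> simp at he <;> simp at this <;> omega
    rw [this, zero_smul]
  · simp

lemma exists_cube (T : Finset Site) : ∃ (w : ℕ) (q : Site), 1 ≤ w ∧ (T : Set Site) ⊆ cube w q := by
  set N := ∑ s ∈ T, ∑ i, (s i).natAbs with hN
  refine ⟨2 * N + 1, fun _ => -N, by omega, fun s hs i => ?_⟩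
  have h1 : (s i).natAbs ≤ ∑ i, (s i).natAbs :=
    Finset.single_le_sum (f := fun i => (s i).natAbs) (fun _ _ => Nat.zero_le _)
      (Finset.mem_univ i)
  have h2 : ∑ i, (s i).natAbs ≤ N :=
    Finset.single_le_sum (f := fun s : Site => ∑ i, (s i).natAbs) (fun _ _ => Nat.zero_le _) hs
  push_cast
  omega

include hv in
-- The generators contained in a cube of side `w` are independent and number `(w - 1)^3`, which
-- attains the upper bound for operators on the cube without syndrome.
lemma exists_genMap_of_syndrome (h2 : (2 : k) ≠ 0) {s : k} (hs : s * s = 1)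
    (hanti : ∀ e, v (antipode e) = s • v e) {u : Site →₀ k × k} (hu : syndrome v u = 0) :
    ∃ h, genMap v h = u := by
  obtain ⟨w, q, hw, hq⟩ := exists_cube u.support
  have hle : (onCube k k (w - 1) q).map (genMap v) ≤
      onCube k (k × k) w q ⊓ LinearMap.ker (syndrome v) := by
    rintro _ ⟨h, hh, rfl⟩
    refine ⟨mem_onCube.2 fun t ht => ?_, syndrome_genMap h2 hs hanti h⟩
    rw [genMap_apply]
    refine Finset.sum_eq_zero fun e _ => ?_
    rw [mem_onCube.1 hh _ fun hc => ht fun i => ?_, zero_smul]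
    have := hc i
    rcases e with ⟨_ | _, _ | _, _ | _⟩ <;> fin_cases i <;> simp at this ⊢ <;> omega
  have hfin : Module.finrank k ((onCube k k (w - 1) q).map (genMap v)) = (w - 1) ^ 3 := by
    rw [← (Submodule.equivMapOfInjective _ (genMap_injective hv) _).finrank_eq, finrank_onCube,
      Module.finrank_self, mul_one]
  have hfd : FiniteDimensional k (onCube k (k × k) w q ⊓ LinearMap.ker (syndrome v) :
      Submodule k (Site →₀ k × k)) := Submodule.finiteDimensional_inf_left _ _
  have heq := Submodule.eq_of_le_of_finrank_le hle
    (by rw [hfin]; exact finrank_onCube_inf_ker_le hv w q)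
  have hmem : u ∈ onCube k (k × k) w q ⊓ LinearMap.ker (syndrome v) := ⟨hq, hu⟩
  rw [← heq] at hmem
  obtain ⟨h, -, hh⟩ := hmem
  exact ⟨h, hh⟩

/-! ### Neutral clusters and splitting of long segments -/

section Neutral

variable {L : Type*} [Field L] [Algebra k L] {x y z : L}

lemma map_evalMap_onCube (hx : x ≠ 0) (hy : y ≠ 0) (hz : z ≠ 0) (w : ℕ) (q : Site) :
    (onCube k k (w + 1) q).map (evalMap k x y z) =
      (boxSpan k x y z w w w).map (LinearMap.mulLeft k (x ^ q 0 * y ^ q 1 * z ^ q 2)) := by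
  rw [onCube, Finsupp.supported_eq_span_single, Submodule.map_span, boxSpan, Submodule.map_span]
  congr 1
  ext m
  constructor
  · rintro ⟨_, ⟨s, hs, rfl⟩, rfl⟩
    have h0 := hs 0
    have h1 := hs 1
    have h2 := hs 2
    push_cast at h0 h1 h2
    obtain ⟨i, hi⟩ := Int.eq_ofNat_of_zero_le (show 0 ≤ s 0 - q 0 by omega)
    obtain ⟨j, hj⟩ := Int.eq_ofNat_of_zero_le (show 0 ≤ s 1 - q 1 by omega)
    obtain ⟨l, hl⟩ := Int.eq_ofNat_of_zero_le (show 0 ≤ s 2 - q 2 by omega)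
    refine ⟨_, ⟨i, by omega, j, by omega, l, by omega, rfl⟩, ?_⟩
    rw [evalMap, Finsupp.linearCombination_single, one_smul, LinearMap.mulLeft_apply,
      show s 0 = q 0 + i by omega, show s 1 = q 1 + j by omega, show s 2 = q 2 + l by omega,
      zpow_add₀ hx, zpow_add₀ hy, zpow_add₀ hz, zpow_natCast, zpow_natCast, zpow_natCast]
    ring
  · rintro ⟨_, ⟨i, hi, j, hj, l, hl, rfl⟩, rfl⟩
    refine ⟨_, ⟨![q 0 + i, q 1 + j, q 2 + l], ?_, rfl⟩, ?_⟩
    · intro t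
      fin_cases t <;> simp <;> omega
    · rw [evalMap, Finsupp.linearCombination_single, one_smul, LinearMap.mulLeft_apply]
      simp [zpow_add₀ hx, zpow_add₀ hy, zpow_add₀ hz]
      ring

include hv in
/-- A neutral cluster of violated generators is created locally. -/
lemma exists_onCube_of_evalMap_eq_zero (hcurve : CubeCurve k x y z) {s : k}
    (hanti : ∀ e, v (antipode e) = s • v e)
    (h1 : ∑ e, (v e).1 • cubeMon x y z e = 0) (h2 : ∑ e, (v e).2 • cubeMon x y z e = 0)
    {w : ℕ} (hw : 1 ≤ w) {q : Site} {e : Site →₀ k} (he : e ∈ onCube k k (w + 1) (q - 1))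
    (hev : evalMap k x y z e = 0) : ∃ u ∈ onCube k (k × k) w q, syndrome v u = e := by
  have hle : (onCube k (k × k) w q).map (syndrome v) ≤
      onCube k k (w + 1) (q - 1) ⊓ LinearMap.ker (evalMap k x y z) := by
    rintro _ ⟨u, hu, rfl⟩
    refine ⟨mem_onCube.2 fun c hc => ?_,
      evalMap_syndrome hcurve.ne1 hcurve.ne2 hcurve.ne3 hanti h1 h2 u⟩
    rw [syndrome_apply]
    refine Finset.sum_eq_zero fun e _ => ?_
    rw [mem_onCube.1 hu _ fun hc' => hc fun i => ?_]
    · simp [cross]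
    have := hc' i
    rcases e with ⟨_ | _, _ | _, _ | _⟩ <;> fin_cases i <;> simp at this ⊢ <;> omega
  have f1 := finrank_map_add_finrank_inf_ker (syndrome v) (onCube k (k × k) w q)
  have f2 := finrank_onCube_inf_ker_le hv w q
  have f3 := finrank_map_add_finrank_inf_ker (evalMap k x y z) (onCube k k (w + 1) (q - 1))
  have hne : x ^ (q - 1) 0 * y ^ (q - 1) 1 * z ^ (q - 1) 2 ≠ 0 :=
    mul_ne_zero (mul_ne_zero (zpow_ne_zero _ hcurve.ne1) (zpow_ne_zero _ hcurve.ne2))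
      (zpow_ne_zero _ hcurve.ne3)
  rw [map_evalMap_onCube hcurve.ne1 hcurve.ne2 hcurve.ne3, finrank_map_mulLeft hne,
    hcurve.finrank w w w hw hw hw, finrank_onCube, Module.finrank_self, mul_one] at f3
  rw [finrank_onCube, Module.finrank_prod, Module.finrank_self] at f1
  have hfd : FiniteDimensional k (onCube k k (w + 1) (q - 1) ⊓ LinearMap.ker (evalMap k x y z) :
      Submodule k (Site →₀ k)) := Submodule.finiteDimensional_inf_left _ _
  -- The dimensions match by `2 w ^ 3 - (w - 1) ^ 3 = (w + 1) ^ 3 - 6 w`: at least the left side for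
  -- the syndromes created in the cube, exactly the right side for neutral clusters.
  have heq := Submodule.eq_of_le_of_finrank_le hle (by
    obtain ⟨m, rfl⟩ := Nat.exists_eq_add_of_le' hw
    rw [Nat.add_sub_cancel] at f2
    nlinarith [f1, f2, f3])
  have hmem : e ∈ onCube k k (w + 1) (q - 1) ⊓ LinearMap.ker (evalMap k x y z) := ⟨he, hev⟩
  rw [← heq] at hmem
  exact hmem

include hv in
/-- An operator violating only generators near two distant cubes is, up to generators, a product
of operators supported in the two cubes. -/
theorem exists_split (hcurve : CubeCurve k x y z) (hk : (2 : k) ≠ 0) {s : k} (hs : s * s = 1)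
    (hanti : ∀ e, v (antipode e) = s • v e)
    (h1 : ∑ e, (v e).1 • cubeMon x y z e = 0) (h2 : ∑ e, (v e).2 • cubeMon x y z e = 0)
    {w : ℕ} (hw : 1 ≤ w) {q₁ q₂ : Site} (hlen : 3 * (w : ℤ) < ∑ i, |q₂ i - q₁ i|)
    {u : Site →₀ k × k} (hu : ∀ c, c ∉ cube (w + 1) (q₁ - 1) → c ∉ cube (w + 1) (q₂ - 1) →
      syndrome v u c = 0) :
    ∃ u₁ ∈ onCube k (k × k) w q₁, ∃ u₂ ∈ onCube k (k × k) w q₂, ∃ h,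
      u + genMap v h = u₁ + u₂ := by
  classical
  set e := syndrome v u with he
  set e₁ := e.filter (· ∈ cube (w + 1) (q₁ - 1)) with he₁
  set e₂ := e.filter (· ∉ cube (w + 1) (q₁ - 1)) with he₂
  have hsum : e₁ + e₂ = e := Finsupp.filter_add_filter_not _ _
  have m1 : e₁ ∈ onCube k k (w + 1) (q₁ - 1) :=
    mem_onCube.2 fun c hc => Finsupp.filter_apply_neg _ _ hc
  have m2 : e₂ ∈ onCube k k (w + 1) (q₂ - 1) := by
    refine mem_onCube.2 fun c hc => ?_
    by_cases hc1 : c ∈ cube (w + 1) (q₁ - 1)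
    · exact Finsupp.filter_apply_neg _ _ (not_not.2 hc1)
    · rw [he₂, Finsupp.filter_apply_pos (· ∉ cube (w + 1) (q₁ - 1)) e hc1, hu c hc1 hc]
  have hev : evalMap k x y z e₁ + evalMap k x y z e₂ = 0 := by
    rw [← map_add, hsum, he, evalMap_syndrome hcurve.ne1 hcurve.ne2 hcurve.ne3 hanti h1 h2]
  have b1 := Submodule.mem_map_of_mem (f := evalMap k x y z) m1
  have b2 := Submodule.mem_map_of_mem (f := evalMap k x y z) m2
  rw [map_evalMap_onCube hcurve.ne1 hcurve.ne2 hcurve.ne3] at b1 b2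
  obtain ⟨E₁, hE₁, hE₁'⟩ := b1
  obtain ⟨E₂, hE₂, hE₂'⟩ := b2
  rw [LinearMap.mulLeft_apply] at hE₁' hE₂'
  have hne : x ^ (q₁ - 1) 0 * y ^ (q₁ - 1) 1 * z ^ (q₁ - 1) 2 ≠ 0 :=
    mul_ne_zero (mul_ne_zero (zpow_ne_zero _ hcurve.ne1) (zpow_ne_zero _ hcurve.ne2))
      (zpow_ne_zero _ hcurve.ne3)
  -- Opposite charges, with the position of the first anchor divided out: a nonzero `E₂` would have
  -- two representatives too far apart.
  have hrel : x ^ (q₂ - q₁) 0 * y ^ (q₂ - q₁) 1 * z ^ (q₂ - q₁) 2 * E₂ = -E₁ := by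
    rw [← mul_right_inj' hne, ← mul_assoc, ← siteMon_add hcurve.ne1 hcurve.ne2 hcurve.ne3,
      show q₁ - 1 + (q₂ - q₁) = q₂ - 1 by abel, hE₂', mul_neg, hE₁']
    linear_combination hev
  have hE₂0 : E₂ = 0 := by
    by_contra h0
    have := hcurve.exponents_le' (q₂ - q₁) h0 hE₂ (by rw [hrel]; exact neg_mem hE₁)
    simp only [Pi.sub_apply] at this
    omega
  have hE₁0 : E₁ = 0 := by rw [hE₂0, mul_zero] at hrel; exact neg_eq_zero.1 hrel.symm
  rw [hE₁0, mul_zero] at hE₁'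
  rw [hE₂0, mul_zero] at hE₂'
  obtain ⟨u₁, hu₁, hs₁⟩ := exists_onCube_of_evalMap_eq_zero hv hcurve hanti h1 h2 hw m1 hE₁'.symm
  obtain ⟨u₂, hu₂, hs₂⟩ := exists_onCube_of_evalMap_eq_zero hv hcurve hanti h1 h2 hw m2 hE₂'.symm
  obtain ⟨h, hh⟩ := exists_genMap_of_syndrome hv hk hs hanti (u := u₁ + u₂ - u)
    (by rw [map_sub, map_add, hs₁, hs₂, hsum, he, sub_self])
  exact ⟨u₁, hu₁, u₂, hu₂, h, by rw [hh]; abel⟩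

end Neutral

end Counting
-- Multiplication and commutation of Pauli operators
section Pauli

variable {p : ℕ}

/-- The exponent `∑ₛ (u s)₂ f(s)`. -/
def phaseSum (u : Site →₀ SympPair p) (f : Config p) : ZMod p := u.sum fun s a => a.2 * f s

lemma phaseSum_add_left (u w : Site →₀ SympPair p) (f : Config p) :
    phaseSum (u + w) f = phaseSum u f + phaseSum w f :=
  Finsupp.sum_add_index' (by simp) (by intro s a b; simp [add_mul])

lemma phaseSum_sub_right (u : Site →₀ SympPair p) (f g : Config p) :
    phaseSum u (fun s => f s - g s) = phaseSum u f - phaseSum u g := by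
  simp only [phaseSum, mul_sub, Finsupp.sum_sub]

lemma phaseSum_single_left (s : Site) (a : SympPair p) (f : Config p) :
    phaseSum (Finsupp.single s a) f = a.2 * f s := by
  rw [phaseSum, Finsupp.sum_single_index]; simp

lemma phaseSum_comm (u w : Site →₀ SympPair p) :
    phaseSum u (fun s => (w s).1) = w.sum fun s b => b.1 * (u s).2 := by
  induction u using Finsupp.induction_linear with
  | zero => simp [phaseSum]
  | add u u' hu hu' =>
    rw [phaseSum_add_left, hu, hu', ← Finsupp.sum_add]
    refine Finsupp.sum_congr fun s _ => ?_
    simp [mul_add]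
  | single t a =>
    rw [phaseSum_single_left, Finsupp.sum_eq_single t]
    · simp [mul_comm]
    · intro s _ hs
      rw [Finsupp.single_eq_of_ne hs]; simp
    · simp

variable [NeZero p]

lemma pauliProd_single (u : Site →₀ SympPair p) (c : Config p) (t : ℂ) :
    pauliProd u (Finsupp.single c t) =
      Finsupp.single (fun s => c s - (u s).1) (t * ZMod.stdAddChar (phaseSum u c)) := by
  rw [pauliProd, Finsupp.linearCombination_single, Finsupp.smul_single, smul_eq_mul]
  rfl

lemma pauliProd_mul (u w : Site →₀ SympPair p) :
    pauliProd u * pauliProd w =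
      (ZMod.stdAddChar (-phaseSum u fun s => (w s).1) : ℂ) • pauliProd (u + w) := by
  refine Finsupp.lhom_ext fun c t => ?_
  rw [Module.End.mul_apply, pauliProd_single, pauliProd_single, LinearMap.smul_apply,
    pauliProd_single, Finsupp.smul_single, smul_eq_mul, phaseSum_sub_right, phaseSum_add_left,
    mul_assoc, ← AddChar.map_add_eq_mul, mul_left_comm, ← AddChar.map_add_eq_mul]
  congr 1
  · ext s
    rw [Finsupp.add_apply, Prod.fst_add]; ring
  · congr 2; ring

lemma pauliProd_zero : pauliProd (0 : Site →₀ SympPair p) = 1 := by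
  refine Finsupp.lhom_ext fun c t => ?_
  rw [pauliProd_single]
  simp [phaseSum]

lemma stdAddChar_ne_zero (t : ZMod p) : (ZMod.stdAddChar t : ℂ) ≠ 0 := by
  intro h
  have h1 : (ZMod.stdAddChar t : ℂ) * ZMod.stdAddChar (-t) = 1 := by
    rw [← AddChar.map_add_eq_mul]; simp
  rw [h, zero_mul] at h1
  exact zero_ne_one h1

lemma smul_pauliProd_injective {a b : ℂ} {u : Site →₀ SympPair p}
    (h : a • pauliProd u = b • pauliProd u) : a = b := by
  have h1 := LinearMap.congr_fun h (Finsupp.single 0 1)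
  rw [LinearMap.smul_apply, LinearMap.smul_apply, pauliProd_single, Finsupp.smul_single,
    Finsupp.smul_single, smul_eq_mul, smul_eq_mul] at h1
  exact mul_right_cancel₀ (mul_ne_zero one_ne_zero (stdAddChar_ne_zero _))
    (Finsupp.single_injective _ h1)

lemma commute_toEnd_iff (A O : FinitePauli p) : Commute A.toEnd O.toEnd ↔
    phaseSum A.pairs (fun s => (O.pairs s).1) = phaseSum O.pairs (fun s => (A.pairs s).1) := by
  rw [commute_iff_eq, FinitePauli.toEnd, FinitePauli.toEnd, smul_mul_smul_comm,
    smul_mul_smul_comm, pauliProd_mul, pauliProd_mul, add_comm O.pairs,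
    mul_comm (ZMod.stdAddChar O.phase : ℂ)]
  constructor
  · intro h
    rw [smul_smul, smul_smul] at h
    have h1 := smul_pauliProd_injective h
    have h2 := mul_left_cancel₀ (mul_ne_zero (stdAddChar_ne_zero A.phase) (stdAddChar_ne_zero O.phase)) h1
    exact neg_injective (ZMod.injective_stdAddChar h2)
  · intro h; rw [h]

end Pauli

/-! ### From the curve to string-freeness of the code -/

section Code

variable {p : ℕ}

/-- The label of a corner of the unit cube; opposite corners have the same label. -/
def cornerLabel : Bool × Bool × Bool → Fin 4
  | (false, false, false) => 2
  | (false, false, true) => 1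
  | (false, true, false) => 3
  | (false, true, true) => 0
  | (true, false, false) => 0
  | (true, false, true) => 3
  | (true, true, false) => 1
  | (true, true, true) => 2

/-- The pair at a corner of the unit cube. -/
def cornerPair (F : Family) (ξ : Fin 4 → SympPair p) (e : Bool × Bool × Bool) : SympPair p :=
  (if e.1 then (F.sign : ZMod p) else 1) • ξ (cornerLabel e)

lemma cornerPair_antipode (F : Family) (ξ : Fin 4 → SympPair p) (e : Bool × Bool × Bool) :
    cornerPair F ξ (antipode e) = (F.sign : ZMod p) • cornerPair F ξ e := by
  have hl : cornerLabel (antipode e) = cornerLabel e := by revert e; decide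
  rw [cornerPair, cornerPair, hl, smul_smul]
  congr 1
  rcases e with ⟨_ | _, e⟩ <;> cases F <;> simp [antipode, Family.sign]

lemma cross_cornerPair_ne_zero [Fact p.Prime] (F : Family) {ξ : Fin 4 → SympPair p}
    (hξ : Deformable ξ) (e d : Bool × Bool × Bool) (hed : e ≠ d) (hea : e ≠ antipode d) :
    cross (cornerPair F ξ e) (cornerPair F ξ d) ≠ 0 := by
  have hl : cornerLabel e ≠ cornerLabel d := by revert e d; decide
  have hs : ∀ b : Bool, (if b then (F.sign : ZMod p) else 1) ≠ 0 := by
    intro b; cases b <;> cases F <;> simp [Family.sign]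
  have : cross (cornerPair F ξ e) (cornerPair F ξ d) =
      ((if e.1 then (F.sign : ZMod p) else 1) * (if d.1 then (F.sign : ZMod p) else 1)) *
        symp (ξ (cornerLabel e)) (ξ (cornerLabel d)) := by
    simp only [cornerPair, cross, symp, Prod.smul_fst, Prod.smul_snd, smul_eq_mul]; ring
  rw [this]
  exact mul_ne_zero (mul_ne_zero (hs _) (hs _)) (hξ _ _ hl)

variable [Fact p.Prime]

lemma generator_pairs (F : Family) (ξ : Fin 4 → SympPair p) (c : Site) :
    (generator F ξ c).pairs = genPairs (cornerPair F ξ) c := by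
  have h1 : ∀ a, F.sign • a = (F.sign : ZMod p) • (a : SympPair p) := by
    intro a; ext <;> simp
  have c0 : 1 - corner 0 = cornerSite (true, false, false) := by decide
  have c1 : 1 - corner 1 = cornerSite (true, true, false) := by decide
  have c2 : 1 - corner 2 = cornerSite (true, true, true) := by decide
  have c3 : 1 - corner 3 = cornerSite (true, false, true) := by decide
  have d0 : corner 0 = cornerSite (false, true, true) := by decide
  have d1 : corner 1 = cornerSite (false, false, true) := by decide
  have d2 : corner 2 = cornerSite (false, false, false) := by decide
  have d3 : corner 3 = cornerSite (false, true, false) := by decide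
  simp only [generator, genPairs, Fin.sum_univ_four, c0, c1, c2, c3]
  simp only [d0, d1, d2, d3, h1, Fintype.sum_prod_type, Fintype.sum_bool, cornerPair, cornerLabel, if_true, one_smul,
    Bool.false_eq_true, if_false]
  abel

lemma supp_generator {F : Family} {ξ : Fin 4 → SympPair p} {c s : Site}
    (h : s ∈ (generator F ξ c).supp) : ∃ e, s = c + cornerSite e := by
  by_contra hcon
  push Not at hcon
  apply h
  rw [generator_pairs, genPairs, Finsupp.finsetSum_apply]
  exact Finset.sum_eq_zero fun e _ => Finsupp.single_eq_of_ne (hcon e)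

lemma disjoint_supp_generator {F : Family} {ξ : Fin 4 → SympPair p} {c q : Site} {w : ℕ}
    (h : c ∉ cube (w + 1) (q - 1)) : Disjoint (generator F ξ c).supp (cube w q) := by
  rw [Set.disjoint_left]
  intro s hs hc
  obtain ⟨e, rfl⟩ := supp_generator hs
  refine h fun i => ?_
  have := hc i
  rcases e with ⟨_ | _, _ | _, _ | _⟩ <;> fin_cases i <;> simp at this ⊢ <;> omega

lemma Linked.sub_le_one {F : Family} {ξ : Fin 4 → SympPair p} {s t : Site} (h : Linked F ξ s t)
    (i : Fin 3) : |s i - t i| ≤ 1 := by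
  obtain ⟨c, hs, ht⟩ := h
  obtain ⟨e, rfl⟩ := supp_generator hs
  obtain ⟨d, rfl⟩ := supp_generator ht
  rw [Pi.add_apply, Pi.add_apply, add_sub_add_left_eq_sub]
  clear hs ht
  revert e d i; decide

variable [NeZero p]

lemma commute_generator_iff (F : Family) (ξ : Fin 4 → SympPair p) (c : Site)
    (O : FinitePauli p) : Commute (generator F ξ c).toEnd O.toEnd ↔
      syndrome (cornerPair F ξ) O.pairs c = 0 := by
  have hadd : ∀ f : Config p, phaseSum (∑ e, Finsupp.single (c + cornerSite e)
      (cornerPair F ξ e)) f = ∑ e, (cornerPair F ξ e).2 * f (c + cornerSite e) := by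
    intro f
    let g : (Site →₀ SympPair p) →+ ZMod p :=
      ⟨⟨fun u => phaseSum u f, by simp [phaseSum]⟩, fun u w => phaseSum_add_left u w f⟩
    have := map_sum g (fun e => Finsupp.single (c + cornerSite e) (cornerPair F ξ e)) Finset.univ
    refine this.trans (Finset.sum_congr rfl fun e _ => ?_)
    exact phaseSum_single_left _ _ _
  have hsum : (genPairs (cornerPair F ξ) c).sum (fun s b => b.1 * (O.pairs s).2) =
      ∑ e, (cornerPair F ξ e).1 * (O.pairs (c + cornerSite e)).2 := by
    rw [genPairs, ← Finsupp.sum_finsetSum_index (by simp) (by intro s a b; simp [add_mul])]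
    refine Finset.sum_congr rfl fun e _ => ?_
    rw [Finsupp.sum_single_index]; simp
  rw [commute_toEnd_iff, phaseSum_comm O.pairs, generator_pairs, hsum, genPairs, hadd,
    syndrome_apply, eq_comm, ← sub_eq_zero, ← Finset.sum_sub_distrib]
  rfl

/-- Coefficients in `ZMod p` lift to natural exponents, so inverses of generators are not needed;
only a phase is left undetermined. -/
lemma exists_stabilizer (F : Family) (ξ : Fin 4 → SympPair p) (h : Site →₀ ZMod p) :
    ∃ g ∈ stabilizers F ξ, ∃ φ : ZMod p,
      g = (ZMod.stdAddChar φ : ℂ) • pauliProd (genMap (cornerPair F ξ) h) := by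
  have hadd : ∀ h h' : Site →₀ ZMod p,
      (∃ g ∈ stabilizers F ξ, ∃ φ : ZMod p,
        g = (ZMod.stdAddChar φ : ℂ) • pauliProd (genMap (cornerPair F ξ) h)) →
      (∃ g ∈ stabilizers F ξ, ∃ φ : ZMod p,
        g = (ZMod.stdAddChar φ : ℂ) • pauliProd (genMap (cornerPair F ξ) h')) →
      (∃ g ∈ stabilizers F ξ, ∃ φ : ZMod p,
        g = (ZMod.stdAddChar φ : ℂ) • pauliProd (genMap (cornerPair F ξ) (h + h'))) := by
    rintro h h' ⟨g, hg, φ, rfl⟩ ⟨g', hg', φ', rfl⟩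
    refine ⟨_, mul_mem hg hg', φ + φ' + -phaseSum (genMap (cornerPair F ξ) h)
      (fun s => (genMap (cornerPair F ξ) h' s).1), ?_⟩
    rw [smul_mul_smul_comm, pauliProd_mul, smul_smul, ← AddChar.map_add_eq_mul,
      ← AddChar.map_add_eq_mul, map_add (genMap _)]
  have hzero : ∃ g ∈ stabilizers F ξ, ∃ φ : ZMod p,
      g = (ZMod.stdAddChar φ : ℂ) • pauliProd (genMap (cornerPair F ξ) 0) :=
    ⟨1, one_mem _, 0, by simp [pauliProd_zero]⟩
  induction h using Finsupp.induction_linear with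
  | zero => exact hzero
  | add h h' ih ih' => exact hadd _ _ ih ih'
  | single c a =>
    obtain ⟨n, rfl⟩ := ZMod.natCast_zmod_surjective a
    induction n with
    | zero => simpa using hzero
    | succ n ih =>
      rw [Nat.cast_succ, Finsupp.single_add]
      refine hadd _ _ ih ⟨(generator F ξ c).toEnd, Submonoid.subset_closure ⟨c, rfl⟩, 0, ?_⟩
      rw [FinitePauli.toEnd, generator_pairs, genMap, Finsupp.linearCombination_single, one_smul]
      rfl

omit [NeZero p] in
/-- An operator supported in two separated cubes is disconnected. -/
lemma not_isConnectedSegment {F : Family} {ξ : Fin 4 → SympPair p} {O : FinitePauli p} {w : ℕ}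
    {q₁ q₂ : Site} {i : Fin 3} (hi : (w : ℤ) + 1 ≤ |q₂ i - q₁ i|)
    (hO : O.supp ⊆ cube w q₁ ∪ cube w q₂) : ¬ IsConnectedSegment F ξ O w q₁ q₂ := by
  rintro ⟨s, hs, t, ht, -, -, hpath⟩
  have hM : O.supp ∪ {s, t} ⊆ cube w q₁ ∪ cube w q₂ := by
    refine Set.union_subset hO ?_
    rintro a (rfl | rfl)
    · exact Or.inl hs
    · exact Or.inr ht
  have hfar : ∀ a ∈ cube w q₁, ∀ b ∈ cube w q₂, 1 < |a i - b i| := by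
    intro a ha b hb
    have h1 := ha i
    have h2 := hb i
    rcases le_total 0 (q₂ i - q₁ i) with h | h
    · rw [abs_of_nonneg h] at hi
      rw [lt_abs]; omega
    · rw [abs_of_nonpos h] at hi
      rw [lt_abs]; omega
  have hind : ∀ b, Relation.ReflTransGen (fun a b => a ∈ O.supp ∪ {s, t} ∧
      b ∈ O.supp ∪ {s, t} ∧ Linked F ξ a b) s b → b ∈ cube w q₁ := by
    intro b hb
    induction hb with
    | refl => exact hs
    | tail _ hstep ih =>
      rcases hM hstep.2.1 with h | h
      · exact h
      · exact absurd (hstep.2.2.sub_le_one i) (not_le.2 (hfar _ ih _ h))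
  have := hfar t (hind t hpath) t ht
  simp at this

theorem stringFree_of_cubeCurve {L : Type*} [Field L] [Algebra (ZMod p) L] {x y z : L}
    (F : Family) {ξ : Fin 4 → SympPair p} (hξ : Deformable ξ) (hp : (2 : ZMod p) ≠ 0)
    (hcurve : CubeCurve (ZMod p) x y z)
    (h1 : ∑ e, (cornerPair F ξ e).1 • cubeMon x y z e = 0)
    (h2 : ∑ e, (cornerPair F ξ e).2 • cubeMon x y z e = 0) {r : ℕ} (hr : 3 ≤ r) :
    StringFree F ξ r := by
  intro O w q₁ q₂ hw hseg hnon
  by_contra hlen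
  push Not at hlen
  have hlen3 : 3 * (w : ℤ) < ∑ i, |q₂ i - q₁ i| := by
    refine lt_of_le_of_lt ?_ hlen
    exact mul_le_mul_of_nonneg_right (by exact_mod_cast hr) (by positivity)
  have hs : (F.sign : ZMod p) * (F.sign : ZMod p) = 1 := by cases F <;> simp [Family.sign]
  obtain ⟨u₁, hu₁, u₂, hu₂, h, hh⟩ := exists_split (cross_cornerPair_ne_zero F hξ) hcurve hp hs
    (cornerPair_antipode F ξ) h1 h2 hw hlen3 (u := O.pairs) (fun c hc1 hc2 =>
      (commute_generator_iff F ξ c O).1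
        (hseg c (disjoint_supp_generator hc1) (disjoint_supp_generator hc2)))
  obtain ⟨g, hg, φ, hgφ⟩ := exists_stabilizer F ξ h
  -- Three displacements of at most `w` could not add up to more than `3 w`. A gap of `w + 1` leaves
  -- the anchors at distance at least 2 in that coordinate, more than one link can bridge.
  obtain ⟨i, hi⟩ : ∃ i, (w : ℤ) + 1 ≤ |q₂ i - q₁ i| := by
    by_contra hcon
    push Not at hcon
    have b0 := hcon 0
    have b1 := hcon 1
    have b2 := hcon 2
    rw [Fin.sum_univ_three] at hlen3
    omega
  -- The phase absorbs that of the stabilizer and the one from reordering, so that `O'` is exactly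
  -- `O` times `g`.
  let O' : FinitePauli p := ⟨O.phase + φ + -phaseSum O.pairs
    (fun s => (genMap (cornerPair F ξ) h s).1), O.pairs + genMap (cornerPair F ξ) h⟩
  refine not_isConnectedSegment hi ?_ (hnon O' ?_ ⟨g, hg, ?_⟩)
  · intro s hs
    by_contra hcon
    rw [Set.mem_union, not_or] at hcon
    apply hs
    change (O.pairs + genMap (cornerPair F ξ) h) s = 0
    rw [hh, Finsupp.add_apply, mem_onCube.1 hu₁ s hcon.1, mem_onCube.1 hu₂ s hcon.2, add_zero]
  · intro c hc1 hc2
    rw [commute_generator_iff]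
    change syndrome _ (O.pairs + genMap (cornerPair F ξ) h) c = 0
    rw [map_add, syndrome_genMap hp hs (cornerPair_antipode F ξ), add_zero]
    exact (commute_generator_iff F ξ c O).1 (hseg c hc1 hc2)
  · rw [hgφ, FinitePauli.toEnd, FinitePauli.toEnd, smul_mul_smul_comm, pauliProd_mul, smul_smul,
      ← AddChar.map_add_eq_mul, ← AddChar.map_add_eq_mul]

end Code
-- The pairs over `ZMod 5` and the primes below 5
section Five

instance fact_prime_five : Fact (Nat.Prime 5) := ⟨by norm_num⟩

/-- The determinants of the pairs `(1,0), (0,1), (1,1), (3,-3)` at four different labels satisfy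
the conditions of `exists_cubeCurve`. -/
lemma fivePairs_biquadCond (a b c d : Fin 4) (h : [a, b, c, d].Nodup) (s : ZMod 5)
    (hs : s = 1 ∨ s = -1) :
    BiquadCond (symp (fivePairs c) (fivePairs b))
      (symp (fivePairs c) (fivePairs a) + symp (fivePairs d) (fivePairs b))
      (symp (fivePairs d) (fivePairs a))
      (s * (symp (fivePairs c) (fivePairs d) + symp (fivePairs a) (fivePairs b))) := by
  have key : ∀ a b c d : Fin 4, [a, b, c, d].Nodup → ∀ s : ZMod 5, s = 1 ∨ s = -1 →
      symp (fivePairs d) (fivePairs a) ≠ 0 ∧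
      (∀ t : ZMod 5, symp (fivePairs c) (fivePairs b) +
        (symp (fivePairs c) (fivePairs a) + symp (fivePairs d) (fivePairs b)) * t +
        symp (fivePairs d) (fivePairs a) * t ^ 2 ≠ 0) ∧
      (∀ t : ZMod 5, symp (fivePairs c) (fivePairs b) +
        (s * (symp (fivePairs c) (fivePairs d) + symp (fivePairs a) (fivePairs b))) * t -
        symp (fivePairs d) (fivePairs a) * t ^ 2 ≠ 0) ∧
      (symp (fivePairs c) (fivePairs a) + symp (fivePairs d) (fivePairs b) ≠ 0 ∨
        symp (fivePairs c) (fivePairs b) + symp (fivePairs d) (fivePairs a) ≠ 0) := by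
    unfold symp fivePairs
    decide +kernel
  obtain ⟨h1, h2, h3, h4⟩ := key a b c d h s hs
  exact ⟨h1, h2, h3, h4⟩

lemma fivePairs_deformable (σ : Equiv.Perm (Fin 4)) : Deformable (fivePairs ∘ σ) := by
  have key : ∀ i j : Fin 4, i ≠ j → symp (fivePairs i) (fivePairs j) ≠ 0 := by
    unfold symp fivePairs
    decide +kernel
  exact fun i j hij => key _ _ fun h => hij (σ.injective h)

/-- Condition 3 fails for these pairs: `⟨(1,0),(0,1)⟩ = 1` and `⟨(1,1),(3,-3)⟩ = -1` have equal
squares. The irreducibility conditions are therefore verified directly, for both signs and every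
order. -/
lemma fivePairs_stringFree (σ : Equiv.Perm (Fin 4)) (F : Family) :
    StringFree F (fivePairs ∘ σ) 5 := by
  have hξ := fivePairs_deformable σ
  have hsign : (F.sign : ZMod 5) = 1 ∨ (F.sign : ZMod 5) = -1 := by
    cases F <;> simp [Family.sign]
  have hs : (F.sign : ZMod 5) * (F.sign : ZMod 5) = 1 := by cases F <;> simp [Family.sign]
  have hx : Transcendental (ZMod 5)
      (algebraMap (RatFunc (ZMod 5)) (AlgebraicClosure (RatFunc (ZMod 5))) RatFunc.X) :=
    (transcendental_algebraMap_iff (FaithfulSMul.algebraMap_injective _ _)).2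
      RatFunc.transcendental_X
  have hnd : ∀ i j k l : Fin 4, [i, j, k, l].Nodup → [σ i, σ j, σ k, σ l].Nodup := by
    intro i j k l h
    exact h.map σ.injective
  obtain ⟨y, z, hcurve, h1, h2⟩ := exists_cubeCurve hx (cornerPair F (fivePairs ∘ σ)) F.sign hs
    (cornerPair_antipode F _) (cross_cornerPair_ne_zero F hξ)
    (by
      have := fivePairs_biquadCond _ _ _ _ (hnd 0 1 2 3 (by decide)) _ hsign
      simpa [cornerPair, cornerLabel, cross, symp] using this)
    (by
      have := fivePairs_biquadCond _ _ _ _ (hnd 0 3 2 1 (by decide)) _ hsign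
      simpa [cornerPair, cornerLabel, cross, symp] using this)
  exact stringFree_of_cubeCurve F hξ (by decide) hcurve h1 h2 (by norm_num)

lemma inv_fin_two {k : Type*} [Field k] (a b c d : k) :
    (!![a, b; c, d])⁻¹ = (a * d - b * c)⁻¹ • !![d, -b; -c, a] := by
  rw [Matrix.inv_def, Ring.inverse_eq_inv, Matrix.det_fin_two_of, Matrix.adjugate_fin_two_of]

lemma det_sub_inv_fin_two {k : Type*} [Field k] (a b c d : k) :
    (!![a, b; c, d] - !![a, b; c, d]⁻¹).det =
      (a - (a * d - b * c)⁻¹ * d) * (d - (a * d - b * c)⁻¹ * a) -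
        (b + (a * d - b * c)⁻¹ * b) * (c + (a * d - b * c)⁻¹ * c) := by
  rw [inv_fin_two, Matrix.det_fin_two]
  simp

lemma transition_eq {p : ℕ} [Fact p.Prime] (A B C D : SympPair p) :
    transition A B C D =
      !![(A.2 * B.1 - A.1 * B.2)⁻¹ * (A.2 * D.1 - B.2 * C.1),
        (A.2 * B.1 - A.1 * B.2)⁻¹ * (B.2 * C.2 - A.2 * D.2);
        (A.2 * B.1 - A.1 * B.2)⁻¹ * (A.1 * D.1 - B.1 * C.1),
        (A.2 * B.1 - A.1 * B.2)⁻¹ * (B.1 * C.2 - A.1 * D.2)] := by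
  have ht : A.1 * -B.2 - -A.2 * B.1 = A.2 * B.1 - A.1 * B.2 := by ring
  rw [transition, pairMatrix, pairMatrix, inv_fin_two, ht, Matrix.smul_mul]
  ext i j
  fin_cases i <;> fin_cases j <;> simp <;> left <;> ring

lemma fivePairs_noMinimalString (σ : Equiv.Perm (Fin 4)) : NoMinimalString (fivePairs ∘ σ) := by
  have key : ∀ i j k l : Fin 4, [i, j, k, l].Nodup →
      (transition (fivePairs i) (fivePairs j) (fivePairs k) (fivePairs l) -
        (transition (fivePairs i) (fivePairs j) (fivePairs k) (fivePairs l))⁻¹).det ≠ 0 := by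
    simp only [transition_eq, det_sub_inv_fin_two]
    unfold fivePairs
    decide +kernel
  have hnd : ∀ i j k l : Fin 4, [i, j, k, l].Nodup → [σ i, σ j, σ k, σ l].Nodup :=
    fun i j k l h => h.map σ.injective
  rintro T (rfl | rfl | rfl)
  · exact key _ _ _ _ (hnd 2 1 3 0 (by decide))
  · exact key _ _ _ _ (hnd 3 2 0 1 (by decide))
  · exact key _ _ _ _ (hnd 2 1 0 3 (by decide))

end Five

/-- Over the fields with 2 and 3 elements every nonzero square is 1, so deformability alone
contradicts condition 3. -/
lemma not_sufficientCondition {p : ℕ} (hp : p.Prime) (h5 : p < 5) (ξ : Fin 4 → SympPair p) :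
    ¬ SufficientCondition ξ := by
  rintro ⟨hd, -, hsq⟩
  have h23 : p = 2 ∨ p = 3 := by
    interval_cases p <;> simp_all +decide
  have hone : ∀ t : ZMod p, t ≠ 0 → t ^ 2 = 1 := by
    rcases h23 with rfl | rfl <;> decide
  exact hsq 0 1 2 3 (by decide) (by
    rw [hone _ (hd 0 1 (by decide)), hone _ (hd 2 3 (by decide))])

end QuditCode

theorem mainTheorem2 :
    (∀ σ : Equiv.Perm (Fin 4),
      QuditCode.Deformable (QuditCode.fivePairs ∘ σ) ∧
      QuditCode.NoMinimalString (QuditCode.fivePairs ∘ σ) ∧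
      ∀ F : QuditCode.Family, QuditCode.StringFree F (QuditCode.fivePairs ∘ σ) 5) ∧
    (∀ (p : ℕ), p.Prime → p < 5 →
      ∀ ξ : Fin 4 → QuditCode.SympPair p, ¬ QuditCode.SufficientCondition ξ) :=
  ⟨fun σ => ⟨QuditCode.fivePairs_deformable σ, QuditCode.fivePairs_noMinimalString σ,
    QuditCode.fivePairs_stringFree σ⟩, fun _ hp h5 ξ => QuditCode.not_sufficientCondition hp h5 ξ⟩
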